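/- \textbf{Setting.} Let $Q$ be a smooth $n$-dimensional manifold (Hausdorff, second countable, without boundary), $\mathcal G$ a smooth Riemannian metric on $Q$, $V\in C^\infty(Q)$ a potential and $f^1,\dots,f^m\in\Omega^1(Q)$ smooth one-forms. Let $\tau_Q:TQ\to Q$ be the projection, $L(v_q)=\tfrac12\mathcal G(v_q,v_q)-V(q)$, $E_L=\dot q^i\,\partial L/\partial\dot q^i-L$ the energy, $J=dq^i\otimes\partial/\partial\dot q^i$ the canonical almost tangent structure and $\omega_L=-d(J^*dL)$. Let $G$ be the vector field on $TQ$ with $i_G\omega_L=dE_L$, and $Y^a=\sharp_{\mathcal G}(f^a)$. Write $(f^a)^V=\tau_Q^*f^a$ and $X^V=X^i\,\partial/\partial\dot q^i$ for vertical lifts, let $\mathcal G^c=\dot q^k\frac{\partial\mathcal G_{ij}}{\partial q^k}dq^i\otimes dq^j+\mathcal G_{ij}\,dq^i\otimes d\dot q^j+\mathcal G_{ij}\,d\dot q^i\otimes dq^j$ be the complete lift of $\mathcal G$ to $TQ$, with $\flat_{\mathcal G^c}(\xi)=\mathcal G^c(\xi,\cdot)$ and $\sharp_{\mathcal G^c}=\flat_{\mathcal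 G^c}^{-1}$, and let $\mathcal F^V$ be the vertical lift to $TQ$ of the input distribution $\mathcal F=\mathrm{span}\{Y^1,\dots,Y^m\}$. A smooth feedback $u=(u_1,\dots,u_m):TQ\to\mathbb R^m$ gives the closed-loop vector field $\Gamma=G+u_a(Y^a)^V$ on $TQ$ (sum over $a=1,\dots,m$). A set $\mathcal M\subseteq TQ$ is \emph{invariant} under $\Gamma$ if every integral curve of $\Gamma$, defined on an open interval around $0$, that starts in $\mathcal M$ at time $0$ stays in $\mathcal M$. Let $\mathcal M\subseteq TQ$ be a closed embedded submanifold of codimension $m$ (for instance the zero set of a smooth map $\phi:TQ\to\mathbb R^m$ whose differential is surjective at every zero), and suppose that at every $x\in\mathcal M$ the subspaces $T_x\mathcal M$ and $\mathcal F^V_x$ of $T_x(TQ)$ are transversal: $T_x\mathcal M+\mathcal F^V_x=T_x(TQ)$ and $\dim T_x\mathcal M+\dim\mathcal F^V_x=2n$. A \emph{control law} is a map $\tau:\mathcal M\to\mathbb R^m$ that is the restriction to $\mathcal M$ of a smooth feedback on $TQ$ under whose closed-loop vector field $\mathcal M$ is invariant. \textbf{Theorem.} The equation $i_G\omega_L=dE_L$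 has a solution $G$, given by $G=\sharp_{\omega_L}(dE_L)$, and there is exactly one control law $\tau^*:\mathcal M\to\mathbb R^m$. For every smooth feedback $u:TQ\to\mathbb R^m$ with closed-loop vector field $\Gamma=G+u_a(Y^a)^V$ the following are equivalent: \begin{enumerate} \item $\mathcal M$ is invariant under $\Gamma$; \item at every point of $\mathcal M$, $\ i_\Gamma\omega_L-dE_L=-\tau^*_a\,(f^a)^V$ and $\Gamma$ is tangent to $\mathcal M$; \item at every point of $\mathcal M$, $\ i_\Gamma\omega_L-dE_L\in\flat_{\mathcal G^c}(\mathcal F^V)$ and $\Gamma$ is tangent to $\mathcal M$. \end{enumerate} Moreover, at every point of $TQ$, $\mathcal F^V=\mathrm{span}\{\sharp_{\mathcal G^c}((f^a)^V)\}$ and $\flat_{\mathcal G^c}(\mathcal F^V)=\mathrm{span}\{\flat_{\mathcal G^c}((Y^a)^V)\}=\mathrm{span}\{(f^a)^V\}$. -/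

import Mathlib

open Set Bundle
open scoped Manifold ContDiff Topology

noncomputable section

/-! ### Linear algebra -/

section LinearAlgebra

variable {V W W' : Type*}
  [AddCommGroup V] [Module ℝ V] [TopologicalSpace V] [IsTopologicalAddGroup V]
  [ContinuousSMul ℝ V]
  [NormedAddCommGroup W] [NormedSpace ℝ W] [NormedAddCommGroup W'] [NormedSpace ℝ W']

/-- The bilinear form `(v, v') ↦ B (S v) (T v')`. -/
def bilinPullback (B : W →L[ℝ] W' →L[ℝ] ℝ) (S : V →L[ℝ] W) (T : V →L[ℝ] W') :
    V →L[ℝ] V →L[ℝ] ℝ :=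
  (ContinuousLinearMap.precomp ℝ T) ∘L (B ∘L S)

/-- The musical isomorphism `♯`, inverse of `♭ : v ↦ B v ·`, of a nondegenerate bilinear form `B`
on a finite-dimensional space (by convention it is `0` if `B` is degenerate). -/
def sharp (B : V →L[ℝ] V →L[ℝ] ℝ) : (V →L[ℝ] ℝ) →L[ℝ] V :=
  B.inverse

/-- The derivative at `y`, in the direction `v`, of a family `B` of bilinear forms. -/
def bilinDirDeriv (B : W → W →L[ℝ] W →L[ℝ] ℝ) (y v : W) : W →L[ℝ] W →L[ℝ] ℝ :=
  fderiv ℝ B y v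

/-- Two subspaces of `V` are transversal if they span `V` and have complementary dimensions. -/
def Transversal (W₁ W₂ : Submodule ℝ V) : Prop :=
  W₁ ⊔ W₂ = ⊤ ∧ Module.finrank ℝ V = Module.finrank ℝ W₁ + Module.finrank ℝ W₂

end LinearAlgebra

/-! ### Forms, submanifolds and flows on a manifold without boundary -/

section Manifold

variable {F : Type*} [NormedAddCommGroup F] [NormedSpace ℝ F] {H : Type*} [TopologicalSpace H]
  (I : ModelWithCorners ℝ F H) {N : Type*} [TopologicalSpace N] [ChartedSpace H N]

/-- The local representative of a one-form `α` in the preferred chart around `x`: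
its pullback by the inverse of the chart. -/
def oneFormInChart (α : ∀ y : N, TangentSpace I y →L[ℝ] ℝ) (x : N) : F → F →L[ℝ] ℝ :=
  fun y => (α ((extChartAt I x).symm y)) ∘L (mfderiv 𝓘(ℝ, F) I (extChartAt I x).symm y)

/-- The exterior derivative of a one-form, computed in the preferred chart around `x`:
`dα = (∂ᵢ αⱼ - ∂ⱼ αᵢ) dxⁱ ⊗ dxʲ`, that is `dα (v, w) = (D_v α) w - (D_w α) v`. -/
def oneFormExtDeriv (α : ∀ y : N, TangentSpace I y →L[ℝ] ℝ) (x : N) :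
    TangentSpace I x →L[ℝ] TangentSpace I x →L[ℝ] ℝ :=
  let D : F →L[ℝ] F →L[ℝ] ℝ := fderiv ℝ (oneFormInChart I α x) (extChartAt I x x)
  let P : TangentSpace I x →L[ℝ] F := mfderiv I 𝓘(ℝ, F) (extChartAt I x) x
  bilinPullback (D - D.flip) P P

/-- `M` is a closed embedded smooth submanifold of codimension `k`: it is closed and, around each of
its points, it is the zero set of a smooth map to `ℝᵏ` which is a submersion at that point. -/
def IsClosedSubmanifold (k : ℕ) (M : Set N) : Prop :=
  IsClosed M ∧ ∀ p ∈ M, ∃ U : Set N, IsOpen U ∧ p ∈ U ∧ ∃ φ : N → (Fin k → ℝ),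
    ContMDiffOn I 𝓘(ℝ, Fin k → ℝ) ∞ φ U ∧ (∀ x ∈ U, x ∈ M ↔ φ x = 0) ∧
    Function.Surjective (mfderiv I 𝓘(ℝ, Fin k → ℝ) φ p)

/-- The tangent space of an embedded submanifold `M` at `p`: the tangent vectors annihilated by
the differentials of all smooth germs of functions at `p` that vanish on `M`. -/
def submanifoldTangentSpace (M : Set N) (p : N) : Submodule ℝ (TangentSpace I p) where
  carrier := {ξ | ∀ φ : N → ℝ, ContMDiffAt I 𝓘(ℝ, ℝ) ∞ φ p → (∀ᶠ y in 𝓝[M] p, φ y = 0) →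
    mfderiv I 𝓘(ℝ, ℝ) φ p ξ = 0}
  add_mem' := fun ha hb φ h h' => by
    rw [map_add, ha φ h h', hb φ h h', add_zero]
  zero_mem' := fun φ _ _ => map_zero _
  smul_mem' := fun c ξ hξ φ h h' => by
    rw [map_smul, hξ φ h h', smul_zero]

/-- `M` is invariant under the (local) flow of the vector field `X`: every integral curve of `X`
on an open interval around `0` that starts in `M` stays in `M`. -/
def IsFlowInvariant (X : ∀ x : N, TangentSpace I x) (M : Set N) : Prop :=
  ∀ (γ : ℝ → N) (a b : ℝ), (0 : ℝ) ∈ Ioo a b → IsMIntegralCurveOn γ X (Ioo a b) → γ 0 ∈ M →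
    ∀ t ∈ Ioo a b, γ t ∈ M

end Manifold

/-! ### Geometry of the tangent bundle -/

section TangentBundle

variable {E : Type*} [NormedAddCommGroup E] [NormedSpace ℝ E]
  {Q : Type*} [TopologicalSpace Q] [ChartedSpace E Q] [IsManifold 𝓘(ℝ, E) ∞ Q]

/-- The vertical lift `T_q Q → T_x (TQ)` at `x ∈ T_q Q`: the differential at `x` of the inclusion of
the fibre `T_q Q` in `TQ`. It maps `w` to the velocity at `0` of `t ↦ x + t w`. -/
def verticalLift (x : TangentBundle 𝓘(ℝ, E) Q) :
    TangentSpace 𝓘(ℝ, E) x.proj →L[ℝ] TangentSpace 𝓘(ℝ, E).tangent x :=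
  mfderiv 𝓘(ℝ, E) 𝓘(ℝ, E).tangent
    (fun w : E => (⟨x.proj, w⟩ : TangentBundle 𝓘(ℝ, E) Q)) x.snd

/-- The tangent map at `x` of the canonical projection `τ : TQ → Q`. -/
def tangentProj (x : TangentBundle 𝓘(ℝ, E) Q) :
    TangentSpace 𝓘(ℝ, E).tangent x →L[ℝ] TangentSpace 𝓘(ℝ, E) x.proj :=
  mfderiv 𝓘(ℝ, E).tangent 𝓘(ℝ, E) (fun y : TangentBundle 𝓘(ℝ, E) Q => y.proj) x

/-- The canonical almost tangent structure `J = dqⁱ ⊗ ∂/∂q̇ⁱ` on `TQ`. -/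
def almostTangent (x : TangentBundle 𝓘(ℝ, E) Q) :
    TangentSpace 𝓘(ℝ, E).tangent x →L[ℝ] TangentSpace 𝓘(ℝ, E).tangent x :=
  verticalLift x ∘L tangentProj x

/-- The vertical lift `αⱽ = τ^* α` of a one-form `α` on `Q`. -/
def oneFormVerticalLift (α : ∀ q : Q, TangentSpace 𝓘(ℝ, E) q →L[ℝ] ℝ)
    (x : TangentBundle 𝓘(ℝ, E) Q) : TangentSpace 𝓘(ℝ, E).tangent x →L[ℝ] ℝ :=
  α x.proj ∘L tangentProj x

/-- The vertical lift `Xⱽ = Xⁱ ∂/∂q̇ⁱ` of a vector field `X` on `Q`. -/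
def vectorVerticalLift (X : ∀ q : Q, TangentSpace 𝓘(ℝ, E) q)
    (x : TangentBundle 𝓘(ℝ, E) Q) : TangentSpace 𝓘(ℝ, E).tangent x :=
  verticalLift x (X x.proj)

/-- The differential of a function on `TQ`, as a one-form. -/
def functionDifferential (f : TangentBundle 𝓘(ℝ, E) Q → ℝ)
    (x : TangentBundle 𝓘(ℝ, E) Q) : TangentSpace 𝓘(ℝ, E).tangent x →L[ℝ] ℝ :=
  mfderiv 𝓘(ℝ, E).tangent 𝓘(ℝ, ℝ) f x

/-- The energy `E_L = q̇ ∂L/∂q̇ - L` of a Lagrangian `L`. -/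
def energy (L : TangentBundle 𝓘(ℝ, E) Q → ℝ) (x : TangentBundle 𝓘(ℝ, E) Q) : ℝ :=
  functionDifferential L x (verticalLift x x.snd) - L x

/-- The two-form `ω_L = -d(J^*(dL))` on `TQ`, as the map `♭ : ξ ↦ i_ξ ω_L`. -/
def lagrangianForm (L : TangentBundle 𝓘(ℝ, E) Q → ℝ) (x : TangentBundle 𝓘(ℝ, E) Q) :
    TangentSpace 𝓘(ℝ, E).tangent x →L[ℝ] TangentSpace 𝓘(ℝ, E).tangent x →L[ℝ] ℝ :=
  -oneFormExtDeriv 𝓘(ℝ, E).tangent (fun y => functionDifferential L y ∘L almostTangent y) x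

/-- The Euler-Lagrange vector field `♯_{ω_L}(dE_L)`, solution `G` of `i_G ω_L = dE_L`. -/
def eulerLagrangeField (L : TangentBundle 𝓘(ℝ, E) Q → ℝ) (x : TangentBundle 𝓘(ℝ, E) Q) :
    TangentSpace 𝓘(ℝ, E).tangent x :=
  sharp (lagrangianForm L x) (functionDifferential (energy L) x)

/-- The matrix `𝒢ᵢⱼ` of a Riemannian metric in the preferred chart of `Q` around `q`,
as a function on the chart. -/
def metricInChart (g : ContMDiffRiemannianMetric 𝓘(ℝ, E) ∞ E (TangentSpace 𝓘(ℝ, E) : Q → Type _))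
    (q : Q) : E → E →L[ℝ] E →L[ℝ] ℝ := fun y =>
  let T : E →L[ℝ] E := mfderiv 𝓘(ℝ, E) 𝓘(ℝ, E) (extChartAt 𝓘(ℝ, E) q).symm y
  bilinPullback (W := E) (W' := E) (g.inner ((extChartAt 𝓘(ℝ, E) q).symm y)) T T

/-- The complete lift `𝒢ᶜ` of a Riemannian metric to `TQ`, given in natural bundle coordinates
`(qⁱ, q̇ⁱ)` by `q̇ᵏ ∂ₖ𝒢ᵢⱼ dqⁱ ⊗ dqʲ + 𝒢ᵢⱼ dqⁱ ⊗ dq̇ʲ + 𝒢ᵢⱼ dq̇ⁱ ⊗ dqʲ`,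
as the map `♭ : ξ ↦ 𝒢ᶜ(ξ, ·)`. -/
def completeLift
    (g : ContMDiffRiemannianMetric 𝓘(ℝ, E) ∞ E (TangentSpace 𝓘(ℝ, E) : Q → Type _))
    (x : TangentBundle 𝓘(ℝ, E) Q) :
    TangentSpace 𝓘(ℝ, E).tangent x →L[ℝ] TangentSpace 𝓘(ℝ, E).tangent x →L[ℝ] ℝ :=
  let P : TangentSpace 𝓘(ℝ, E).tangent x →L[ℝ] E × E :=
    mfderiv 𝓘(ℝ, E).tangent 𝓘(ℝ, E × E) (extChartAt 𝓘(ℝ, E).tangent x) x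
  let dq : TangentSpace 𝓘(ℝ, E).tangent x →L[ℝ] E := ContinuousLinearMap.fst ℝ E E ∘L P
  let dv : TangentSpace 𝓘(ℝ, E).tangent x →L[ℝ] E := ContinuousLinearMap.snd ℝ E E ∘L P
  let c : E × E := extChartAt 𝓘(ℝ, E).tangent x x
  let g₀ : E →L[ℝ] E →L[ℝ] ℝ := metricInChart g x.proj c.1
  let dg : E →L[ℝ] E →L[ℝ] ℝ := bilinDirDeriv (metricInChart g x.proj) c.1 c.2
  bilinPullback dg dq dq + bilinPullback g₀ dq dv + bilinPullback g₀ dv dq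

end TangentBundle

/-! ### Mechanical control systems -/

/-- The data of a mechanical control system `∇_{q̇} q̇ = -grad V + u_a Y^a` on `Q`: a Riemannian
metric, a potential function `V` and one-forms `f¹, …, fᵐ`, all smooth; `Y^a = ♯_𝒢(f^a)`. -/
structure MechanicalControlSystem (E : Type*) [NormedAddCommGroup E] [NormedSpace ℝ E]
    (Q : Type*) [TopologicalSpace Q] [ChartedSpace E Q] [IsManifold 𝓘(ℝ, E) ∞ Q] (m : ℕ) where
  metric : ContMDiffRiemannianMetric 𝓘(ℝ, E) ∞ E (TangentSpace 𝓘(ℝ, E) : Q → Type _)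
  potential : Q → ℝ
  potential_smooth : ContMDiff 𝓘(ℝ, E) 𝓘(ℝ, ℝ) ∞ potential
  force : Fin m → ∀ q : Q, TangentSpace 𝓘(ℝ, E) q →L[ℝ] ℝ
  force_smooth : ∀ a, ContMDiff 𝓘(ℝ, E) (𝓘(ℝ, E).prod 𝓘(ℝ, E →L[ℝ] ℝ)) ∞
    (fun q => TotalSpace.mk' (E →L[ℝ] ℝ)
      (E := fun q : Q => TangentSpace 𝓘(ℝ, E) q →L[ℝ] Bundle.Trivial Q ℝ q) q (force a q))

namespace MechanicalControlSystem

variable {E : Type*} [NormedAddCommGroup E] [NormedSpace ℝ E]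
  {Q : Type*} [TopologicalSpace Q] [ChartedSpace E Q] [IsManifold 𝓘(ℝ, E) ∞ Q] {m : ℕ}
  (S : MechanicalControlSystem E Q m)

/-- The Lagrangian of mechanical type `L(v) = ½ 𝒢(v, v) - V(τ v)`. -/
def lagrangian (x : TangentBundle 𝓘(ℝ, E) Q) : ℝ :=
  1 / 2 * S.metric.inner x.proj x.snd x.snd - S.potential x.proj

/-- The control force vector fields `Y^a = ♯_𝒢(f^a)`. -/
def controlField (a : Fin m) (q : Q) : TangentSpace 𝓘(ℝ, E) q :=
  sharp (S.metric.inner q) (S.force a q)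

/-- The input distribution `ℱ = span {Y^a}` on `Q`. -/
def inputDistribution (q : Q) : Submodule ℝ (TangentSpace 𝓘(ℝ, E) q) :=
  Submodule.span ℝ (range fun a => S.controlField a q)

/-- The vertical lift `ℱⱽ` of the input distribution, a distribution on `TQ`. -/
def liftedInputDistribution (x : TangentBundle 𝓘(ℝ, E) Q) :
    Submodule ℝ (TangentSpace 𝓘(ℝ, E).tangent x) :=
  (S.inputDistribution x.proj).map (verticalLift x).toLinearMap

/-- The closed-loop vector field `Γ = G + u_a (Y^a)ⱽ` of a feedback `u : TQ → ℝᵐ`, where `G` is the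
Euler-Lagrange vector field of the mechanical Lagrangian. -/
def closedLoopField (u : TangentBundle 𝓘(ℝ, E) Q → Fin m → ℝ) (x : TangentBundle 𝓘(ℝ, E) Q) :
    TangentSpace 𝓘(ℝ, E).tangent x :=
  eulerLagrangeField S.lagrangian x + ∑ a, u x a • vectorVerticalLift (S.controlField a) x

/-- The one-form `i_Γ ω_L - dE_L` of a vector field `Γ` on `TQ`. -/
def chetaevForm (Γ : ∀ x : TangentBundle 𝓘(ℝ, E) Q, TangentSpace 𝓘(ℝ, E).tangent x)
    (x : TangentBundle 𝓘(ℝ, E) Q) : TangentSpace 𝓘(ℝ, E).tangent x →L[ℝ] ℝ :=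
  lagrangianForm S.lagrangian x (Γ x) - functionDifferential (energy S.lagrangian) x

/-- `τ : M → ℝᵐ` is a (smooth) control law making `M` a virtual nonholonomic constraint: it is the
restriction to `M` of a smooth feedback on `TQ` whose closed-loop flow leaves `M` invariant. -/
def IsControlLaw (M : Set (TangentBundle 𝓘(ℝ, E) Q)) (τ : M → Fin m → ℝ) : Prop :=
  ∃ u : TangentBundle 𝓘(ℝ, E) Q → Fin m → ℝ,
    ContMDiff 𝓘(ℝ, E).tangent 𝓘(ℝ, Fin m → ℝ) ∞ u ∧ (∀ x : M, u x = τ x) ∧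
    IsFlowInvariant 𝓘(ℝ, E).tangent (S.closedLoopField u) M

end MechanicalControlSystem

end

/-!
A `C¹` function `h` vanishing on the zero set of a submersion `φ` satisfies `h = O(φ)` locally.
Hence the tangent space of `M = {φ = 0}` is `ker dφ`; and if `X` is a vector field tangent to `M`,
so that `dφ(X)` vanishes on `M`, then `(φ ∘ γ)' = O(φ ∘ γ)` along integral curves `γ`, so `φ ∘ γ`
stays zero by Grönwall's inequality. Invariance of `M` is thus the same as tangency of `Γ` to `M`.

In terms of `φ`, tangency of `G + u_a (Y^a)ⱽ` is a linear system for `u` whose matrix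
`(dφ_i((Y^a)ⱽ))` is invertible exactly because `ℱⱽ` is transversal to `M`. This determines `u` on
`M`; the local solutions extend smoothly off `M` and, the tangency condition being convex in `u`,
are glued by a partition of unity.

The forms `ω_L = -d(𝒢ᵢⱼ q̇ⁱ dqʲ)` and `𝒢ᶜ` pair a vertical lift `wⱽ` with any `ξ` as
`-𝒢(w, Tτ ξ)` and `𝒢(w, Tτ ξ)`, respectively. This yields their nondegeneracy, and
`i_{(Y^a)ⱽ} ω_L = -(f^a)ⱽ`, `♭_{𝒢ᶜ}((Y^a)ⱽ) = (f^a)ⱽ`. Consequently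
`i_Γ ω_L - dE_L = -u_a (f^a)ⱽ`. Moreover a vector field `X` with `i_X dθ = β`, for smooth `θ` and
`β` with `dθ` nondegenerate, is smooth; this applies to `G` and to `(Y^a)ⱽ`.
-/

/-! ### Zero sets of submersions -/

section ZeroSet

open Filter Asymptotics Metric

variable {F F₁ F₂ : Type*} [NormedAddCommGroup F] [NormedSpace ℝ F]
  [NormedAddCommGroup F₁] [NormedSpace ℝ F₁] [NormedAddCommGroup F₂] [NormedSpace ℝ F₂]
  {f : F → F₁} {f' : F →L[ℝ] F₁} {h : F → F₂} {h' : F →L[ℝ] F₂} {p : F}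

theorem exists_zero_norm_sub_le_of_surjective [CompleteSpace F] [CompleteSpace F₁]
    (hf : HasStrictFDerivAt f f' p) (hp : f p = 0) (hsurj : Function.Surjective f')
    {s : Set F} (hs : s ∈ 𝓝 p) :
    ∃ C : ℝ, ∀ᶠ y in 𝓝 p, ∃ z ∈ s, f z = 0 ∧ ‖y - z‖ ≤ C * ‖f y‖ := by
  have hrange : f'.range = ⊤ := LinearMap.range_eq_top.2 hsurj
  set R := f'.nonlinearRightInverseOfSurjective hrange
  have hR : 0 < R.nnnorm := f'.nonlinearRightInverseOfSurjective_nnnorm_pos hrange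
  obtain ⟨t, ht, hft⟩ := hf.approximates_deriv_on_nhds (c := R.nnnorm⁻¹ / 2)
    (Or.inr (by positivity))
  obtain ⟨r, hr, hrt⟩ := nhds_basis_closedBall.mem_iff.1 (inter_mem hs ht)
  set C : ℝ := 2 * R.nnnorm with hC
  have hlim : Tendsto (fun y => ‖y - p‖ + C * ‖f y‖) (𝓝 p) (𝓝 0) := by
    have hcont := hf.continuousAt
    have : ContinuousAt (fun y => ‖y - p‖ + C * ‖f y‖) p := by fun_prop
    simpa [ContinuousAt, hp] using this
  refine ⟨C, ?_⟩
  filter_upwards [hlim.eventually (gt_mem_nhds hr)] with y hy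
  have hball : closedBall y (C * ‖f y‖) ⊆ closedBall p r :=
    closedBall_subset_closedBall' (by rw [dist_eq_norm]; linarith)
  have hradius : ((R.nnnorm : ℝ)⁻¹ - (R.nnnorm⁻¹ / 2 : NNReal)) * (C * ‖f y‖) = ‖f y‖ := by
    have : (R.nnnorm : ℝ) ≠ 0 := by positivity
    push_cast [hC]
    field_simp
    ring
  have hzero : (0 : F₁) ∈ closedBall (f y)
      (((R.nnnorm : ℝ)⁻¹ - (R.nnnorm⁻¹ / 2 : NNReal)) * (C * ‖f y‖)) := by
    rw [hradius, mem_closedBall, dist_zero_left]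
  obtain ⟨z, hz, hz0⟩ := hft.surjOn_closedBall_of_nonlinearRightInverse R
    (by positivity) (hball.trans (hrt.trans inter_subset_right)) hzero
  exact ⟨z, (hrt (hball hz)).1, hz0, by rwa [mem_closedBall', dist_eq_norm] at hz⟩

theorem isBigO_of_eq_zero_of_surjective [CompleteSpace F] [CompleteSpace F₁]
    (hf : HasStrictFDerivAt f f' p) (hp : f p = 0) (hsurj : Function.Surjective f')
    (hh : HasStrictFDerivAt h h' p) (h0 : ∀ᶠ y in 𝓝 p, f y = 0 → h y = 0) :
    h =O[𝓝 p] f := by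
  obtain ⟨K, t, ht, hK⟩ := hh.exists_lipschitzOnWith
  obtain ⟨C, hC⟩ := exists_zero_norm_sub_le_of_surjective hf hp hsurj (inter_mem ht h0)
  refine IsBigO.of_bound (K * C) ?_
  filter_upwards [hC, ht] with y ⟨z, ⟨hzt, hz⟩, hfz, hyz⟩ hyt
  calc ‖h y‖ = ‖h y - h z‖ := by rw [hz hfz, sub_zero]
    _ ≤ K * ‖y - z‖ := hK.norm_sub_le hyt hzt
    _ ≤ K * (C * ‖f y‖) := by gcongr
    _ = K * C * ‖f y‖ := by ring

theorem apply_eq_zero_of_isBigO (hf : HasFDerivAt f f' p) (hp : f p = 0)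
    (hh : HasFDerivAt h h' p) (hO : h =O[𝓝 p] f) {v : F} (hv : f' v = 0) : h' v = 0 := by
  have hhp : h p = 0 := hO.eq_zero_imp.self_of_nhds hp
  have hline : Tendsto (fun t : ℝ => p + t • v) (𝓝 0) (𝓝 p) :=
    Continuous.tendsto' (by fun_prop) _ _ (by simp)
  have hft := hasLineDerivAt_iff_isLittleO_nhds_zero.1 (hf.hasLineDerivAt v)
  simp only [hp, hv, smul_zero, sub_zero] at hft
  have hht : HasLineDerivAt ℝ h 0 p v := by
    simpa only [hasLineDerivAt_iff_isLittleO_nhds_zero, hhp, smul_zero, sub_zero]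
      using! (hO.comp_tendsto hline).trans_isLittleO hft
  exact (hh.hasLineDerivAt v).unique hht

theorem eventually_eq_zero_of_norm_deriv_le {ψ ψ' : ℝ → F₁} {t₀ C : ℝ}
    (hψ : ∀ᶠ t in 𝓝 t₀, HasDerivAt ψ (ψ' t) t) (hb : ∀ᶠ t in 𝓝 t₀, ‖ψ' t‖ ≤ C * ‖ψ t‖)
    (h0 : ψ t₀ = 0) : ∀ᶠ t in 𝓝 t₀, ψ t = 0 := by
  obtain ⟨r, hr, hball⟩ := Metric.eventually_nhds_iff_ball.1 (hψ.and hb)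
  have forward {χ χ' : ℝ → F₁}
      (h : ∀ s ∈ Ico 0 r, HasDerivAt χ (χ' s) s ∧ ‖χ' s‖ ≤ C * ‖χ s‖) (hχ : χ 0 = 0) :
      ∀ s ∈ Ico 0 r, χ s = 0 := fun s hs =>
    have hsub {x} (hx : x ∈ Icc 0 s) : x ∈ Ico 0 r := ⟨hx.1, hx.2.trans_lt hs.2⟩
    eq_zero_of_abs_deriv_le_mul_abs_self_of_eq_zero_right
      (fun x hx => (h x (hsub hx)).1.continuousAt.continuousWithinAt)
      (fun x hx => (h x (hsub (Ico_subset_Icc_self hx))).1.hasDerivWithinAt) hχ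
      (fun x hx => (h x (hsub (Ico_subset_Icc_self hx))).2) s ⟨hs.1, le_rfl⟩
  have hball' {s : ℝ} (hs : |s| < r) := hball (t₀ + s) (by simpa [Real.dist_eq] using hs)
  have hright := forward (χ := fun s => ψ (t₀ + s)) (χ' := fun s => ψ' (t₀ + s))
    (fun s hs => have := hball' ((abs_of_nonneg hs.1).trans_lt hs.2)
      ⟨this.1.comp_const_add t₀ s, this.2⟩) (by simpa using h0)
  have hleft := forward (χ := fun s => ψ (t₀ - s)) (χ' := fun s => -ψ' (t₀ - s))
    (fun s hs => have := hball' (s := -s) (by simpa [abs_of_nonneg hs.1] using hs.2)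
      ⟨this.1.comp_const_sub t₀ s, by simpa [sub_eq_add_neg] using this.2⟩) (by simpa using h0)
  filter_upwards [Metric.ball_mem_nhds t₀ hr] with t ht
  rw [Metric.mem_ball, Real.dist_eq, abs_lt] at ht
  rcases le_total t₀ t with h | h
  · simpa using hright (t - t₀) ⟨by linarith, ht.2⟩
  · simpa using hleft (t₀ - t) ⟨by linarith, by linarith⟩

end ZeroSet

/-! ### Invariance of submanifolds under flows -/

section Invariance

open Filter Asymptotics

variable {F : Type*} [NormedAddCommGroup F] [NormedSpace ℝ F] {H : Type*} [TopologicalSpace H]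
  {I : ModelWithCorners ℝ F H} {N : Type*} [TopologicalSpace N] [ChartedSpace H N]
  {F₁ F₂ : Type*} [NormedAddCommGroup F₁] [NormedSpace ℝ F₁]
  [NormedAddCommGroup F₂] [NormedSpace ℝ F₂]
  {M U : Set N} {p : N} {X : ∀ x : N, TangentSpace I x}

section ChartRepresentative

variable {φ : N → F₁} {h : N → F₂}

theorem hasFDerivAt_comp_extChartAt_symm [I.Boundaryless]
    (hφ : MDifferentiableAt I 𝓘(ℝ, F₁) φ p) :
    HasFDerivAt (E := F) (φ ∘ (extChartAt I p).symm) (mvfderiv I φ p) (extChartAt I p p) :=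
  HasFDerivWithinAt.hasFDerivAt (E := F) hφ.hasMFDerivAt.2 (by simp [I.range_eq_univ])

theorem hasStrictFDerivAt_comp_extChartAt_symm [I.Boundaryless]
    (hφ : ContMDiffAt I 𝓘(ℝ, F₁) 1 φ p) :
    HasStrictFDerivAt (E := F) (φ ∘ (extChartAt I p).symm) (mvfderiv I φ p) (extChartAt I p p) := by
  have h : ContDiffAt ℝ 1 (φ ∘ (extChartAt I p).symm) (extChartAt I p p) := by
    simpa [I.range_eq_univ, contDiffWithinAt_univ] using! (contMDiffAt_iff.1 hφ).2
  exact h.hasStrictFDerivAt'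
    (hasFDerivAt_comp_extChartAt_symm (hφ.mdifferentiableAt one_ne_zero)) one_ne_zero

theorem tendsto_extChartAt_symm_nhds (p : N) :
    Tendsto (extChartAt I p).symm (𝓝 (extChartAt I p p)) (𝓝 p) := by
  simpa [ContinuousAt] using continuousAt_extChartAt_symm (I := I) p

theorem isBigO_of_eq_zero_of_mvfderiv_surjective [I.Boundaryless]
    [CompleteSpace F] [CompleteSpace F₁] (hφ : ContMDiffAt I 𝓘(ℝ, F₁) 1 φ p) (hp : φ p = 0)
    (hsurj : Function.Surjective (mvfderiv I φ p)) (hh : ContMDiffAt I 𝓘(ℝ, F₂) 1 h p)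
    (h0 : ∀ᶠ y in 𝓝 p, φ y = 0 → h y = 0) : h =O[𝓝 p] φ := by
  have hO := isBigO_of_eq_zero_of_surjective (hasStrictFDerivAt_comp_extChartAt_symm hφ)
    (by simpa using hp) hsurj (hasStrictFDerivAt_comp_extChartAt_symm hh)
    ((tendsto_extChartAt_symm_nhds p).eventually h0)
  refine (hO.comp_tendsto (continuousAt_extChartAt (I := I) p)).congr' ?_ ?_ <;>
  · filter_upwards [extChartAt_source_mem_nhds (I := I) p] with y hy
    simp only [Function.comp_apply, (extChartAt I p).left_inv hy]

theorem mvfderiv_apply_eq_zero_of_isBigO [I.Boundaryless]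
    (hφ : MDifferentiableAt I 𝓘(ℝ, F₁) φ p) (hp : φ p = 0)
    (hh : MDifferentiableAt I 𝓘(ℝ, F₂) h p) (hO : h =O[𝓝 p] φ) {ξ : TangentSpace I p}
    (hξ : mvfderiv I φ p ξ = 0) : mvfderiv I h p ξ = 0 :=
  apply_eq_zero_of_isBigO (hasFDerivAt_comp_extChartAt_symm hφ) (by simpa using hp)
    (hasFDerivAt_comp_extChartAt_symm hh) (hO.comp_tendsto (tendsto_extChartAt_symm_nhds p)) hξ

theorem contMDiffAt_mvfderiv_apply [IsManifold I 1 N] {n k : ℕ∞ω} (hk : k + 1 ≤ n) (hU : IsOpen U)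
    (hφ : ContMDiffOn I 𝓘(ℝ, F₁) n φ U) (hp : p ∈ U)
    (hX : ContMDiffAt I I.tangent k (fun x => (⟨x, X x⟩ : TangentBundle I N)) p) :
    ContMDiffAt I 𝓘(ℝ, F₁) k (fun y => mvfderiv I φ y (X y)) p := by
  have htangent : ContMDiffAt I 𝓘(ℝ, F₁).tangent k (tangentMapWithin I 𝓘(ℝ, F₁) φ U ∘
      fun x => (⟨x, X x⟩ : TangentBundle I N)) p :=
    ((hφ.contMDiffOn_tangentMapWithin hk hU.uniqueMDiffOn).contMDiffAt
      ((hU.preimage (FiberBundle.continuous_proj F (TangentSpace I))).mem_nhds hp)).comp p hX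
  refine ((contMDiff_snd_tangentBundle_modelSpace F₁ 𝓘(ℝ, F₁) (n := k)).contMDiffAt.comp p
    htangent).congr_of_eventuallyEq ?_
  filter_upwards [hU.mem_nhds hp] with y hy
  change mvfderiv I φ y (X y) = mfderivWithin I 𝓘(ℝ, F₁) φ U y (X y)
  rw [mfderivWithin_of_isOpen hU hy]
  rfl

theorem hasDerivAt_comp_of_hasMFDerivAt {γ : ℝ → N} {t : ℝ} {ξ : TangentSpace I (γ t)}
    (hφ : MDifferentiableAt I 𝓘(ℝ, F₁) φ (γ t))
    (hγ : HasMFDerivAt 𝓘(ℝ, ℝ) I γ t ((1 : ℝ →L[ℝ] ℝ).smulRight ξ)) :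
    HasDerivAt (φ ∘ γ) (mvfderiv I φ (γ t) ξ) t := by
  have h : HasFDerivAt (φ ∘ γ)
    (mvfderiv I φ (γ t) ∘L ContinuousLinearMap.smulRight (1 : ℝ →L[ℝ] ℝ) ξ) t :=
    (hφ.hasMFDerivAt.comp t hγ).hasFDerivAt
  simpa using! h.hasDerivAt

end ChartRepresentative

variable (I) in
/-- `φ` is a smooth map on the open set `U` that cuts out `M ∩ U` as its zero set. No rank
condition is imposed, so that a local equation of a submanifold is one at nearby points too. -/
structure IsLocalEquation (M : Set N) (φ : N → F₁) (U : Set N) : Prop where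
  isOpen : IsOpen U
  contMDiffOn : ContMDiffOn I 𝓘(ℝ, F₁) ∞ φ U
  mem_iff : ∀ x ∈ U, x ∈ M ↔ φ x = 0

theorem exists_isLocalEquation_of_isClosedSubmanifold {k : ℕ} (hM : IsClosedSubmanifold I k M)
    (hp : p ∈ M) : ∃ (U : Set N) (φ : N → Fin k → ℝ), p ∈ U ∧ IsLocalEquation I M φ U ∧
      Function.Surjective (mvfderiv I φ p) := by
  obtain ⟨U, hU, hpU, φ, hφ, hφM, hsurj⟩ := hM.2 p hp
  exact ⟨U, φ, hpU, ⟨hU, hφ, hφM⟩, hsurj⟩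

namespace IsLocalEquation

variable {φ : N → F₁} (hφ : IsLocalEquation I M φ U) (hp : p ∈ U)

include hφ hp

theorem contMDiffAt : ContMDiffAt I 𝓘(ℝ, F₁) ∞ φ p :=
  hφ.contMDiffOn.contMDiffAt (hφ.isOpen.mem_nhds hp)

theorem mdifferentiableAt : MDifferentiableAt I 𝓘(ℝ, F₁) φ p :=
  (hφ.contMDiffAt hp).mdifferentiableAt (by simp)

theorem eventually_eq_zero : ∀ᶠ x in 𝓝[M] p, φ x = 0 := by
  filter_upwards [self_mem_nhdsWithin, mem_nhdsWithin_of_mem_nhds (hφ.isOpen.mem_nhds hp)]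
    with x hxM hxU using (hφ.mem_iff x hxU).1 hxM

theorem mvfderiv_apply_eq_zero {ξ : TangentSpace I p} (hξ : ξ ∈ submanifoldTangentSpace I M p) :
    mvfderiv I φ p ξ = 0 := by
  refine SeparatingDual.eq_zero_of_forall_dual_eq_zero (R := ℝ) fun ℓ => ?_
  have hℓ : ContMDiff 𝓘(ℝ, F₁) 𝓘(ℝ, ℝ) ∞ ℓ := ℓ.contMDiff
  have hzero := hξ (ℓ ∘ φ) (hℓ.contMDiffAt.comp p (hφ.contMDiffAt hp))
    ((hφ.eventually_eq_zero hp).mono fun x hx => by simp [hx])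
  rw [mfderiv_comp p ℓ.mdifferentiableAt (hφ.mdifferentiableAt hp),
    ContinuousLinearMap.mfderiv_eq] at hzero
  exact hzero

variable [I.Boundaryless] [CompleteSpace F] [CompleteSpace F₁]
  (hpM : p ∈ M) (hsurj : Function.Surjective (mvfderiv I φ p))

include hpM hsurj

theorem isBigO {h : N → F₂} (hh : ContMDiffAt I 𝓘(ℝ, F₂) 1 h p)
    (h0 : ∀ᶠ x in 𝓝[M] p, h x = 0) : h =O[𝓝 p] φ := by
  refine isBigO_of_eq_zero_of_mvfderiv_surjective ((hφ.contMDiffAt hp).of_le (by simp))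
    ((hφ.mem_iff p hp).1 hpM) hsurj hh ?_
  filter_upwards [eventually_nhdsWithin_iff.1 h0, hφ.isOpen.mem_nhds hp] with x hx hxU hφx
  exact hx ((hφ.mem_iff x hxU).2 hφx)

theorem mem_submanifoldTangentSpace_iff (ξ : TangentSpace I p) :
    ξ ∈ submanifoldTangentSpace I M p ↔ mvfderiv I φ p ξ = 0 := by
  refine ⟨hφ.mvfderiv_apply_eq_zero hp, fun hξ h hh h0 => ?_⟩
  exact mvfderiv_apply_eq_zero_of_isBigO (hφ.mdifferentiableAt hp) ((hφ.mem_iff p hp).1 hpM)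
    (hh.mdifferentiableAt (by simp)) (hφ.isBigO hp hpM hsurj (hh.of_le (by simp)) h0) hξ

end IsLocalEquation

theorem mem_submanifoldTangentSpace_of_isFlowInvariant [I.Boundaryless] [IsManifold I 1 N]
    [CompleteSpace F] (hp : p ∈ M)
    (hX : ContMDiffAt I I.tangent 1 (fun x => (⟨x, X x⟩ : TangentBundle I N)) p)
    (h : IsFlowInvariant I X M) : X p ∈ submanifoldTangentSpace I M p := by
  intro f hf hfM
  obtain ⟨γ, rfl, hγ⟩ := exists_isMIntegralCurveAt_of_contMDiffAt_boundaryless 0 hX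
  obtain ⟨r, hr, hball⟩ := isMIntegralCurveAt_iff'.1 hγ
  rw [Real.ball_eq_Ioo, zero_sub, zero_add] at hball
  have h0 : (0 : ℝ) ∈ Ioo (-r) r := ⟨neg_lt_zero.2 hr, hr⟩
  have hin := h γ (-r) r h0 hball hp
  have hlim : Tendsto γ (𝓝 0) (𝓝[M] (γ 0)) :=
    tendsto_nhdsWithin_of_tendsto_nhds_of_eventually_within _ hγ.continuousAt
      (mem_of_superset (Ioo_mem_nhds h0.1 h0.2) hin)
  exact (hasDerivAt_comp_of_hasMFDerivAt (hf.mdifferentiableAt (by simp)) hγ.hasMFDerivAt).unique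
    ((hasDerivAt_const (0 : ℝ) (0 : ℝ)).congr_of_eventuallyEq (hlim.eventually hfM))

theorem eventually_mem_of_isMIntegralCurveAt [I.Boundaryless] [IsManifold I 1 N]
    [CompleteSpace F] {k : ℕ} (hM : IsClosedSubmanifold I k M)
    (hX : ContMDiff I I.tangent 1 (fun x => (⟨x, X x⟩ : TangentBundle I N)))
    (htangent : ∀ x ∈ M, X x ∈ submanifoldTangentSpace I M x) {γ : ℝ → N} {t₀ : ℝ}
    (hγ : IsMIntegralCurveAt γ X t₀) (hmem : γ t₀ ∈ M) : ∀ᶠ t in 𝓝 t₀, γ t ∈ M := by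
  obtain ⟨U, φ, hU, hφ, hsurj⟩ := exists_isLocalEquation_of_isClosedSubmanifold hM hmem
  have hγU : ∀ᶠ t in 𝓝 t₀, γ t ∈ U := hγ.continuousAt.eventually (hφ.isOpen.mem_nhds hU)
  have hO : (fun x => mvfderiv I φ x (X x)) =O[𝓝 (γ t₀)] φ := by
    refine hφ.isBigO hU hmem hsurj
      (contMDiffAt_mvfderiv_apply (by norm_cast) hφ.isOpen hφ.contMDiffOn hU (hX _)) ?_
    filter_upwards [self_mem_nhdsWithin, mem_nhdsWithin_of_mem_nhds (hφ.isOpen.mem_nhds hU)]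
      with x hxM hxU using hφ.mvfderiv_apply_eq_zero hxU (htangent x hxM)
  obtain ⟨C, hC⟩ := hO.bound
  have hderiv : ∀ᶠ t in 𝓝 t₀, HasDerivAt (φ ∘ γ) (mvfderiv I φ (γ t) (X (γ t))) t := by
    filter_upwards [hγ, hγU] with t ht htU
    exact hasDerivAt_comp_of_hasMFDerivAt (hφ.mdifferentiableAt htU) ht
  filter_upwards [hγU, eventually_eq_zero_of_norm_deriv_le hderiv (hγ.continuousAt.eventually hC)
    ((hφ.mem_iff _ hU).1 hmem)] with t htU ht using (hφ.mem_iff _ htU).2 ht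

theorem isFlowInvariant_of_forall_mem_submanifoldTangentSpace [I.Boundaryless] [IsManifold I 1 N]
    [CompleteSpace F] {k : ℕ} (hM : IsClosedSubmanifold I k M)
    (hX : ContMDiff I I.tangent 1 (fun x => (⟨x, X x⟩ : TangentBundle I N)))
    (htangent : ∀ x ∈ M, X x ∈ submanifoldTangentSpace I M x) : IsFlowInvariant I X M := by
  intro γ a b h0 hγ hmem t ht
  have : PreconnectedSpace (Ioo a b) := Subtype.preconnectedSpace isPreconnected_Ioo
  have hclopen : IsClopen {s : Ioo a b | γ s ∈ M} := by
    refine ⟨hM.1.preimage hγ.continuousOn.domRestrict, isOpen_iff_mem_nhds.2 fun s hs => ?_⟩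
    exact continuous_subtype_val.continuousAt.eventually (eventually_mem_of_isMIntegralCurveAt hM hX
      htangent (hγ.isMIntegralCurveAt (Ioo_mem_nhds s.2.1 s.2.2)) hs)
  exact eq_univ_iff_forall.1 (hclopen.eq_univ ⟨⟨0, h0⟩, hmem⟩) ⟨t, ht⟩

theorem isFlowInvariant_iff_forall_mem_submanifoldTangentSpace [I.Boundaryless] [IsManifold I 1 N]
    [CompleteSpace F] {k : ℕ} (hM : IsClosedSubmanifold I k M)
    (hX : ContMDiff I I.tangent 1 (fun x => (⟨x, X x⟩ : TangentBundle I N))) :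
    IsFlowInvariant I X M ↔ ∀ x ∈ M, X x ∈ submanifoldTangentSpace I M x :=
  ⟨fun h _ hx => mem_submanifoldTangentSpace_of_isFlowInvariant hx (hX _) h,
    isFlowInvariant_of_forall_mem_submanifoldTangentSpace hM hX⟩

end Invariance

/-! ### Feedbacks tangent to a submanifold -/

section Feedback

open Filter

theorem bijective_linearCombination_of_ker_sup_span_eq_top {ι V : Type*} [Fintype ι]
    [AddCommGroup V] [Module ℝ V] {L : V →ₗ[ℝ] (ι → ℝ)} (hL : Function.Surjective L) {Y : ι → V}
    (h : LinearMap.ker L ⊔ Submodule.span ℝ (range Y) = ⊤) :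
    Function.Bijective (Fintype.linearCombination ℝ (fun a => L (Y a))) := by
  have hsurj : Function.Surjective (Fintype.linearCombination ℝ (fun a => L (Y a))) := by
    intro w
    obtain ⟨v, rfl⟩ := hL w
    obtain ⟨k, hk, y, hy, rfl⟩ := Submodule.mem_sup.1 (h ▸ Submodule.mem_top (x := v))
    obtain ⟨c, rfl⟩ := (Submodule.mem_span_range_iff_exists_fun ℝ).1 hy
    exact ⟨c, by simp [Fintype.linearCombination_apply, LinearMap.mem_ker.1 hk]⟩
  exact ⟨LinearMap.injective_iff_surjective.2 hsurj, hsurj⟩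

variable {F : Type*} [NormedAddCommGroup F] [NormedSpace ℝ F] {H : Type*} [TopologicalSpace H]
  {I : ModelWithCorners ℝ F H} {N : Type*} [TopologicalSpace N] [ChartedSpace H N]
  {ι : Type*} [Fintype ι] {M U : Set N} {p : N} {φ : N → ι → ℝ}
  {X : ∀ x : N, TangentSpace I x} {Y : ι → ∀ x : N, TangentSpace I x}

/-- The square matrix `dφ(Y_a)` at `x`, seen as the map `c ↦ ∑ c_a dφ(Y_a)`: it relates the
controls `c` to the rate of change of `φ` along `∑ c_a Y_a`. -/
noncomputable def controlMatrix (φ : N → ι → ℝ) (Y : ι → ∀ x : N, TangentSpace I x) (x : N) :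
    (ι → ℝ) →L[ℝ] (ι → ℝ) :=
  ∑ a, (ContinuousLinearMap.proj (R := ℝ) (φ := fun _ : ι => ℝ) a).smulRight
    (mvfderiv I φ x (Y a x))

theorem controlMatrix_apply (c : ι → ℝ) :
    controlMatrix φ Y p c = ∑ a, c a • mvfderiv I φ p (Y a p) := by
  simp [controlMatrix]

theorem mvfderiv_add_sum_smul (ξ : TangentSpace I p) (c : ι → ℝ) :
    mvfderiv I φ p (ξ + ∑ a, c a • Y a p) = mvfderiv I φ p ξ + controlMatrix φ Y p c := by
  simp only [map_add, map_sum, map_smul, controlMatrix_apply]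

theorem surjective_mvfderiv_of_isInvertible_controlMatrix
    (hinv : (controlMatrix φ Y p).IsInvertible) : Function.Surjective (mvfderiv I φ p) := by
  intro w
  obtain ⟨c, rfl⟩ := hinv.bijective.2 w
  exact ⟨∑ a, c a • Y a p, by simp only [map_sum, map_smul, controlMatrix_apply]⟩

theorem contMDiffOn_controlMatrix [IsManifold I 1 N] (hU : IsOpen U)
    (hφ : ContMDiffOn I 𝓘(ℝ, ι → ℝ) ∞ φ U)
    (hY : ∀ a, ContMDiff I I.tangent ∞ (fun x => (⟨x, Y a x⟩ : TangentBundle I N))) :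
    ContMDiffOn I 𝓘(ℝ, (ι → ℝ) →L[ℝ] (ι → ℝ)) ∞ (controlMatrix φ Y) U := by
  refine contMDiffOn_finsetSum fun a _ y hy => ?_
  have hYφ : ContMDiffAt I 𝓘(ℝ, ι → ℝ) ∞ (fun y => mvfderiv I φ y (Y a y)) y :=
    contMDiffAt_mvfderiv_apply (by norm_cast) hU hφ hy (hY a y)
  exact ((ContinuousLinearMap.smulRightL ℝ (ι → ℝ) (ι → ℝ)
    (ContinuousLinearMap.proj a)).contDiff.contDiffAt.comp_contMDiffAt hYφ).contMDiffWithinAt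

namespace IsLocalEquation

variable [I.Boundaryless] [CompleteSpace F]
  (hφ : IsLocalEquation I M φ U) (hp : p ∈ U)

include hφ hp

theorem isInvertible_controlMatrix (hpM : p ∈ M) (hsurj : Function.Surjective (mvfderiv I φ p))
    (htrans : submanifoldTangentSpace I M p ⊔ Submodule.span ℝ (range fun a => Y a p) = ⊤) :
    (controlMatrix φ Y p).IsInvertible := by
  have hker : LinearMap.ker (mvfderiv I φ p).toLinearMap = submanifoldTangentSpace I M p := by
    ext ξ
    exact (hφ.mem_submanifoldTangentSpace_iff hp hpM hsurj ξ).symm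
  have hbij : Function.Bijective (controlMatrix φ Y p).toLinearMap := by
    convert! bijective_linearCombination_of_ker_sup_span_eq_top
      (L := (mvfderiv I φ p).toLinearMap) hsurj (hker ▸ htrans) using 1
    ext1 c
    simp [Fintype.linearCombination_apply, controlMatrix_apply]
  exact ⟨(LinearEquiv.ofBijective _ hbij).toContinuousLinearEquiv, rfl⟩

theorem add_sum_smul_mem_submanifoldTangentSpace_iff (hpM : p ∈ M)
    (hinv : (controlMatrix φ Y p).IsInvertible) (ξ : TangentSpace I p) (c : ι → ℝ) :
    ξ + ∑ a, c a • Y a p ∈ submanifoldTangentSpace I M p ↔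
      c = (controlMatrix φ Y p).inverse (-mvfderiv I φ p ξ) := by
  rw [hφ.mem_submanifoldTangentSpace_iff hp hpM
      (surjective_mvfderiv_of_isInvertible_controlMatrix hinv),
    mvfderiv_add_sum_smul, eq_comm (a := c), hinv.inverse_apply_eq, add_eq_zero_iff_neg_eq]

end IsLocalEquation

variable [I.Boundaryless] {m : ℕ} {Z : Fin m → ∀ x : N, TangentSpace I x}
  (hM : IsClosedSubmanifold I m M)

include hM

theorem existsUnique_add_sum_smul_mem_submanifoldTangentSpace [CompleteSpace F] (hp : p ∈ M)
    (htrans : submanifoldTangentSpace I M p ⊔ Submodule.span ℝ (range fun a => Z a p) = ⊤)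
    (ξ : TangentSpace I p) :
    ∃! c : Fin m → ℝ, ξ + ∑ a, c a • Z a p ∈ submanifoldTangentSpace I M p := by
  obtain ⟨U, φ, hU, hφ, hsurj⟩ := exists_isLocalEquation_of_isClosedSubmanifold hM hp
  have hinv := hφ.isInvertible_controlMatrix hU hp hsurj htrans
  simp only [hφ.add_sum_smul_mem_submanifoldTangentSpace_iff hU hp hinv, existsUnique_eq]

theorem exists_contMDiffOn_add_sum_smul_mem_submanifoldTangentSpace [CompleteSpace F]
    [IsManifold I 1 N] (hX : ContMDiff I I.tangent ∞ (fun x => (⟨x, X x⟩ : TangentBundle I N)))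
    (hZ : ∀ a, ContMDiff I I.tangent ∞ (fun x => (⟨x, Z a x⟩ : TangentBundle I N))) (hp : p ∈ M)
    (htrans : submanifoldTangentSpace I M p ⊔ Submodule.span ℝ (range fun a => Z a p) = ⊤) :
    ∃ U ∈ 𝓝 p, ∃ u : N → Fin m → ℝ, ContMDiffOn I 𝓘(ℝ, Fin m → ℝ) ∞ u U ∧
      ∀ x ∈ U, x ∈ M → X x + ∑ a, u x a • Z a x ∈ submanifoldTangentSpace I M x := by
  obtain ⟨U, φ, hU, hφ, hsurj⟩ := exists_isLocalEquation_of_isClosedSubmanifold hM hp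
  have hA : ContMDiffOn I 𝓘(ℝ, (Fin m → ℝ) →L[ℝ] (Fin m → ℝ)) ∞ (controlMatrix φ Z) U :=
    contMDiffOn_controlMatrix hφ.isOpen hφ.contMDiffOn hZ
  have hinv : ∀ᶠ x in 𝓝 p, (controlMatrix φ Z x).IsInvertible := by
    obtain ⟨e, he⟩ := hφ.isInvertible_controlMatrix hU hp hsurj htrans
    exact (hA.contMDiffAt (hφ.isOpen.mem_nhds hU)).continuousAt.eventually
      (he ▸ ContinuousLinearEquiv.nhds e)
  refine ⟨{x ∈ U | (controlMatrix φ Z x).IsInvertible},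
    inter_mem (hφ.isOpen.mem_nhds hU) hinv,
    fun x => (controlMatrix φ Z x).inverse (-mvfderiv I φ x (X x)), fun x hx => ?_,
    fun x hx hxM =>
      (hφ.add_sum_smul_mem_submanifoldTangentSpace_iff hx.1 hxM hx.2 (X x) _).2 rfl⟩
  have hinverse : ContMDiffAt I 𝓘(ℝ, (Fin m → ℝ) →L[ℝ] (Fin m → ℝ)) ∞
      (fun x => (controlMatrix φ Z x).inverse) x :=
    hx.2.contDiffAt_map_inverse.comp_contMDiffAt (hA.contMDiffAt (hφ.isOpen.mem_nhds hx.1))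
  exact (hinverse.clm_apply (contMDiffAt_mvfderiv_apply (by norm_cast) hφ.isOpen hφ.contMDiffOn hx.1
    (hX x)).neg).contMDiffWithinAt

theorem exists_contMDiff_add_sum_smul_mem_submanifoldTangentSpace [FiniteDimensional ℝ F]
    [IsManifold I ∞ N] [SigmaCompactSpace N] [T2Space N]
    (hX : ContMDiff I I.tangent ∞ (fun x => (⟨x, X x⟩ : TangentBundle I N)))
    (hZ : ∀ a, ContMDiff I I.tangent ∞ (fun x => (⟨x, Z a x⟩ : TangentBundle I N)))
    (htrans : ∀ x ∈ M,
      submanifoldTangentSpace I M x ⊔ Submodule.span ℝ (range fun a => Z a x) = ⊤) :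
    ∃ u : N → Fin m → ℝ, ContMDiff I 𝓘(ℝ, Fin m → ℝ) ∞ u ∧
      ∀ x ∈ M, X x + ∑ a, u x a • Z a x ∈ submanifoldTangentSpace I M x := by
  have : CompleteSpace F := FiniteDimensional.complete ℝ F
  have hconvex (x : N) : Convex ℝ {c : Fin m → ℝ |
      x ∈ M → X x + ∑ a, c a • Z a x ∈ submanifoldTangentSpace I M x} := by
    by_cases hx : x ∈ M
    · refine Set.Subsingleton.convex fun c hc d hd => ?_
      exact (existsUnique_add_sum_smul_mem_submanifoldTangentSpace hM hx (htrans x hx) (X x)).unique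
        (hc hx) (hd hx)
    · simp [hx, convex_univ]
  obtain ⟨u, hu⟩ := exists_contMDiffMap_forall_mem_convex_of_local I (n := ⊤) hconvex fun p => by
    by_cases hp : p ∈ M
    · exact exists_contMDiffOn_add_sum_smul_mem_submanifoldTangentSpace hM hX hZ hp (htrans p hp)
    · exact ⟨Mᶜ, hM.1.isOpen_compl.mem_nhds hp, fun _ => 0, contMDiffOn_const,
        fun y hy hyM => absurd hyM hy⟩
  exact ⟨u, u.contMDiff, fun x hx => hu x hx⟩

end Feedback

/-! ### Exterior derivatives of one-forms in charts -/

section OneForm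

open Filter

theorem isInvertible_bilinPullback_iff {V W : Type*} [AddCommGroup V] [Module ℝ V]
    [TopologicalSpace V] [NormedAddCommGroup W] [NormedSpace ℝ W] {B : W →L[ℝ] W →L[ℝ] ℝ}
    {S : V →L[ℝ] W} (hS : S.IsInvertible) :
    (bilinPullback B S S).IsInvertible ↔ B.IsInvertible := by
  obtain ⟨e, rfl⟩ := hS
  let E : (W →L[ℝ] ℝ) ≃L[ℝ] (V →L[ℝ] ℝ) := e.symm.arrowCongr (.refl ℝ ℝ)
  change ((E : (W →L[ℝ] ℝ) →L[ℝ] (V →L[ℝ] ℝ)) ∘L B ∘L (e : V →L[ℝ] W)).IsInvertible ↔ _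
  rw [ContinuousLinearMap.isInvertible_equiv_comp, ContinuousLinearMap.isInvertible_comp_equiv]

theorem fderiv_pullback_sub_swap {F₁ F₂ : Type*} [NormedAddCommGroup F₁] [NormedSpace ℝ F₁]
    [NormedAddCommGroup F₂] [NormedSpace ℝ F₂] {β : F₂ → F₂ →L[ℝ] ℝ} {κ : F₁ → F₂} {y : F₁}
    (hβ : DifferentiableAt ℝ β (κ y)) (hκ : ContDiffAt ℝ 2 κ y) (v w : F₁) :
    fderiv ℝ (fun z => β (κ z) ∘L fderiv ℝ κ z) y v w -
      fderiv ℝ (fun z => β (κ z) ∘L fderiv ℝ κ z) y w v =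
    fderiv ℝ β (κ y) (fderiv ℝ κ y v) (fderiv ℝ κ y w) -
      fderiv ℝ β (κ y) (fderiv ℝ κ y w) (fderiv ℝ κ y v) := by
  have hβκ : HasFDerivAt (fun z => β (κ z)) (fderiv ℝ β (κ y) ∘L fderiv ℝ κ y) y :=
    hβ.hasFDerivAt.comp y (hκ.differentiableAt (by simp)).hasFDerivAt
  have hκ' : HasFDerivAt (fderiv ℝ κ) (fderiv ℝ (fderiv ℝ κ) y) y :=
    ((hκ.fderiv_right (m := 1) (by norm_num)).differentiableAt (by simp)).hasFDerivAt
  have hsymm := hκ.isSymmSndFDerivAt (by simp) v w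
  rw [(hβκ.clm_comp hκ').fderiv]
  simp [hsymm]

variable {F : Type*} [NormedAddCommGroup F] [NormedSpace ℝ F] {H : Type*} [TopologicalSpace H]
  {I : ModelWithCorners ℝ F H} {N : Type*} [TopologicalSpace N] [ChartedSpace H N]
  {α β θ : ∀ y : N, TangentSpace I y →L[ℝ] ℝ} {X : ∀ x : N, TangentSpace I x} {x x₀ : N}

/-- The exterior derivative of `α` in the preferred chart around `x₀`, as a family of bilinear
forms on the model space; `oneFormExtDeriv` is its value at the centre of the chart. -/
noncomputable def oneFormExtDerivInChart (α : ∀ y : N, TangentSpace I y →L[ℝ] ℝ) (x₀ : N) (y : F) :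
    F →L[ℝ] F →L[ℝ] ℝ :=
  fderiv ℝ (oneFormInChart I α x₀) y - (fderiv ℝ (oneFormInChart I α x₀) y).flip

/-- A one-form is smooth if its local representatives are. This is phrased through the preferred
charts, rather than as smoothness of a section of the cotangent bundle, because exterior
derivatives are computed there. -/
def IsSmoothOneForm (α : ∀ y : N, TangentSpace I y →L[ℝ] ℝ) : Prop :=
  ∀ x₀, ContDiffOn ℝ ∞ (oneFormInChart I α x₀) (extChartAt I x₀).target

theorem oneFormExtDeriv_swap (α : ∀ y : N, TangentSpace I y →L[ℝ] ℝ) (ξ η : TangentSpace I x) :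
    oneFormExtDeriv I α x ξ η = -oneFormExtDeriv I α x η ξ :=
  (neg_sub _ _).symm

theorem contDiffOn_oneFormExtDerivInChart [I.Boundaryless] (hθ : IsSmoothOneForm θ) (x₀ : N) :
    ContDiffOn ℝ ∞ (oneFormExtDerivInChart θ x₀) (extChartAt I x₀).target := by
  have hD := (hθ x₀).fderiv_of_isOpen (isOpen_extChartAt_target x₀) (m := ∞) (by simp)
  exact hD.sub (ContDiff.comp_contDiffOn (g := ContinuousLinearMap.flipₗᵢ ℝ F F ℝ)
    (LinearIsometryEquiv.contDiff _) hD)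

theorem contMDiffAt_of_mvfderiv_extChartAt [IsManifold I 1 N] {n : ℕ∞ω}
    (hX : ContMDiffAt I 𝓘(ℝ, F) n (fun x => mvfderiv I (extChartAt I x₀) x (X x)) x₀) :
    ContMDiffAt I I.tangent n (fun x => (⟨x, X x⟩ : TangentBundle I N)) x₀ := by
  refine (contMDiffAt_section x₀).2 (hX.congr_of_eventuallyEq ?_)
  filter_upwards [(chartAt H x₀).open_source.mem_nhds (mem_chart_source H x₀)] with x hx
  refine Eq.trans ?_ (DFunLike.congr_fun
    (TangentBundle.continuousLinearMapAt_trivializationAt (I := I) hx) (X x))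
  have hmem : x ∈ (trivializationAt F (TangentSpace I) x₀).baseSet :=
    (TangentBundle.trivializationAt_baseSet (I := I) x₀).symm ▸ hx
  exact (Trivialization.coe_linearMapAt_of_mem (R := ℝ) _ hmem).symm ▸ rfl

section

variable [I.Boundaryless] [IsManifold I 1 N]

theorem mdifferentiableAt_extChartAt_symm {y : F} (hy : y ∈ (extChartAt I x).target) :
    MDifferentiableAt 𝓘(ℝ, F) I (extChartAt I x).symm y := by
  simpa only [I.range_eq_univ, mdifferentiableWithinAt_univ] using
    mdifferentiableWithinAt_extChartAt_symm hy

theorem mfderiv_extChartAt_symm_mvfderiv_extChartAt (hx : x ∈ (extChartAt I x₀).source)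
    (ξ : TangentSpace I x) :
    mfderiv 𝓘(ℝ, F) I (extChartAt I x₀).symm (extChartAt I x₀ x)
      (mvfderiv I (extChartAt I x₀) x ξ) = ξ := by
  have h := mfderivWithin_extChartAt_symm_comp_mfderiv_extChartAt' hx
  rw [I.range_eq_univ, mfderivWithin_univ] at h
  exact DFunLike.congr_fun h ξ

theorem oneForm_apply_eq_oneFormInChart (α : ∀ y : N, TangentSpace I y →L[ℝ] ℝ)
    (hx : x ∈ (extChartAt I x₀).source) (ξ : TangentSpace I x) :
    α x ξ = oneFormInChart I α x₀ (extChartAt I x₀ x) (mvfderiv I (extChartAt I x₀) x ξ) := by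
  have hα {y : N} (hy : y = x) (v : F) : α y v = α x v := by rw [hy]
  change α x ξ = α _ (mfderiv 𝓘(ℝ, F) I (extChartAt I x₀).symm (extChartAt I x₀ x)
    (mvfderiv I (extChartAt I x₀) x ξ))
  rw [mfderiv_extChartAt_symm_mvfderiv_extChartAt hx]
  exact (hα ((extChartAt I x₀).left_inv hx) ξ).symm

theorem oneFormInChart_eventuallyEq (α : ∀ y : N, TangentSpace I y →L[ℝ] ℝ)
    (hx : x ∈ (extChartAt I x₀).source) :
    oneFormInChart I α x =ᶠ[𝓝 (extChartAt I x x)] fun y =>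
      oneFormInChart I α x₀ ((extChartAt I x₀ ∘ (extChartAt I x).symm) y) ∘L
        fderiv ℝ (extChartAt I x₀ ∘ (extChartAt I x).symm) y := by
  filter_upwards [(tendsto_extChartAt_symm_nhds x).eventually
    ((isOpen_extChartAt_source x₀).mem_nhds hx), extChartAt_target_mem_nhds x] with y hy hyx
  ext v
  change α ((extChartAt I x).symm y) (mfderiv 𝓘(ℝ, F) I (extChartAt I x).symm y v) = _
  rw [oneForm_apply_eq_oneFormInChart α hy]
  have hd := mfderiv_comp y (mdifferentiableAt_extChartAt (by simpa using! hy))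
    (mdifferentiableAt_extChartAt_symm hyx)
  rw [mfderiv_eq_fderiv] at hd
  exact congrArg _ (DFunLike.congr_fun hd v).symm

end

variable [I.Boundaryless]

theorem oneFormExtDeriv_eq_bilinPullback [IsManifold I 2 N]
    (hx : x ∈ (extChartAt I x₀).source)
    (hα : DifferentiableAt ℝ (oneFormInChart I α x₀) (extChartAt I x₀ x)) :
    oneFormExtDeriv I α x = bilinPullback (oneFormExtDerivInChart α x₀ (extChartAt I x₀ x))
      (mvfderiv I (extChartAt I x₀) x) (mvfderiv I (extChartAt I x₀) x) := by
  have : IsManifold I 1 N := IsManifold.of_le (n := 2) (by simp)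
  set κ : F → F := extChartAt I x₀ ∘ (extChartAt I x).symm
  have hκx : κ (extChartAt I x x) = extChartAt I x₀ x := by simp [κ]
  have hsource : x ∈ (chartAt H x₀).source := by simpa using! hx
  have hκ : ContDiffAt ℝ 2 κ (extChartAt I x x) := by
    simpa [I.range_eq_univ, contDiffWithinAt_univ] using!
      (contMDiffAt_iff.1 (contMDiffAt_extChartAt' (I := I) (n := 2) hsource)).2
  have hκ' : fderiv ℝ κ (extChartAt I x x) = mvfderiv I (extChartAt I x₀) x :=
    HasFDerivAt.fderiv (𝕜 := ℝ) (E := F) (F := F)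
      (hasFDerivAt_comp_extChartAt_symm (mdifferentiableAt_extChartAt hsource))
  have hpullback := fderiv_pullback_sub_swap (hκx ▸ hα) hκ
  rw [← (oneFormInChart_eventuallyEq α hx).fderiv_eq, hκx, hκ'] at hpullback
  ext ξ η
  have hself : mfderiv I 𝓘(ℝ, F) (extChartAt I x) x = ContinuousLinearMap.id ℝ F :=
    mfderiv_extChartAt_self
  rw [oneFormExtDeriv, hself]
  exact hpullback ξ η

theorem contMDiff_of_oneFormExtDeriv_eq [IsManifold I ∞ N] [CompleteSpace F]
    (hθ : IsSmoothOneForm θ) (hβ : IsSmoothOneForm β)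
    (hinv : ∀ x, (oneFormExtDeriv I θ x).IsInvertible)
    (hX : ∀ x, oneFormExtDeriv I θ x (X x) = β x) :
    ContMDiff I I.tangent ∞ (fun x => (⟨x, X x⟩ : TangentBundle I N)) := by
  intro x₀
  set Ω := oneFormExtDerivInChart θ x₀
  have hnhds {x} (hx : x ∈ (extChartAt I x₀).source) :
      (extChartAt I x₀).target ∈ 𝓝 (extChartAt I x₀ x) :=
    (isOpen_extChartAt_target x₀).mem_nhds ((extChartAt I x₀).map_source hx)
  have hΩ {x} (hx : x ∈ (extChartAt I x₀).source) := oneFormExtDeriv_eq_bilinPullback hx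
    (((hθ x₀).contDiffAt (hnhds hx)).differentiableAt (by simp))
  have hΩinv {x} (hx : x ∈ (extChartAt I x₀).source) : (Ω (extChartAt I x₀ x)).IsInvertible :=
    (isInvertible_bilinPullback_iff (W := F) (isInvertible_mfderiv_extChartAt hx)).1
      (hΩ hx ▸ hinv x)
  have hx₀ := mem_extChartAt_source (I := I) x₀
  have hsmooth : ContDiffAt ℝ ∞ (fun z => (Ω z).inverse (oneFormInChart I β x₀ z))
      (extChartAt I x₀ x₀) :=
    (ContDiffAt.comp _ (hΩinv hx₀).contDiffAt_map_inverse
      ((contDiffOn_oneFormExtDerivInChart hθ x₀).contDiffAt (hnhds hx₀))).clm_apply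
      ((hβ x₀).contDiffAt (hnhds hx₀))
  refine contMDiffAt_of_mvfderiv_extChartAt
    ((hsmooth.comp_contMDiffAt (contMDiffAt_extChartAt (x := x₀))).congr_of_eventuallyEq ?_)
  filter_upwards [extChartAt_source_mem_nhds (I := I) x₀] with x hx
  refine ((hΩinv hx).inverse_apply_eq.2 ?_).symm
  refine ContinuousLinearMap.ext fun v : F => ?_
  obtain ⟨η, rfl⟩ := (isInvertible_mfderiv_extChartAt (I := I) hx).surjective v
  exact (oneForm_apply_eq_oneFormInChart β hx η).symm.trans
    ((DFunLike.congr_fun ((hX x).symm.trans (DFunLike.congr_fun (hΩ hx) _)) η))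

theorem isSmoothOneForm_mvfderiv [IsManifold I ∞ N] {f : N → ℝ} (hf : ContMDiff I 𝓘(ℝ, ℝ) ∞ f) :
    IsSmoothOneForm (fun x => mvfderiv I f x) := by
  intro x₀
  have hlocal : ContDiffOn ℝ ∞ (f ∘ (extChartAt I x₀).symm) (extChartAt I x₀).target :=
    contMDiffOn_iff_contDiffOn.1 (hf.comp_contMDiffOn (contMDiffOn_extChartAt_symm x₀))
  refine (hlocal.fderiv_of_isOpen (m := ∞) (isOpen_extChartAt_target x₀) (by simp)).congr
    fun z hz => ?_
  have hcomp := mfderiv_comp z ((hf _).mdifferentiableAt (by simp))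
    (mdifferentiableAt_extChartAt_symm hz)
  rw [mfderiv_eq_fderiv] at hcomp
  exact hcomp.symm

end OneForm

/-! ### Topology of the tangent bundle -/

section FiberBundle

variable {B F : Type*} {V : B → Type*} [TopologicalSpace B] [TopologicalSpace F]
  [TopologicalSpace (TotalSpace F V)] [∀ b, TopologicalSpace (V b)] [FiberBundle F V]

variable (F V)

theorem t2Space_totalSpace [T2Space B] [T2Space F] : T2Space (TotalSpace F V) := by
  refine ⟨fun x y hxy => ?_⟩
  by_cases hproj : x.proj = y.proj
  · let e := trivializationAt F V x.proj
    have hx : x ∈ e.source := FiberBundle.mem_trivializationAt_proj_source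
    have hy : y ∈ e.source :=
      e.mem_source.2 (hproj ▸ FiberBundle.mem_baseSet_trivializationAt' x.proj)
    obtain ⟨U, W, hU, hW, hxU, hyW, hUW⟩ := t2_separation (e.injOn.ne hx hy hxy)
    exact ⟨e.source ∩ e ⁻¹' U, e.source ∩ e ⁻¹' W,
      e.continuousOn.isOpen_inter_preimage e.open_source hU,
      e.continuousOn.isOpen_inter_preimage e.open_source hW, ⟨hx, hxU⟩, ⟨hy, hyW⟩,
      (hUW.preimage e).mono inter_subset_right inter_subset_right⟩
  · obtain ⟨U, W, hU, hW, hxU, hyW, hUW⟩ := t2_separation hproj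
    have hcont := FiberBundle.continuous_proj F V
    exact ⟨_, _, hU.preimage hcont, hW.preimage hcont, hxU, hyW, hUW.preimage _⟩

theorem secondCountableTopology_totalSpace [SecondCountableTopology B]
    [SecondCountableTopology F] : SecondCountableTopology (TotalSpace F V) := by
  obtain ⟨s, hs, hcover⟩ := TopologicalSpace.countable_cover_nhds fun b : B =>
    (trivializationAt F V b).open_baseSet.mem_nhds (FiberBundle.mem_baseSet_trivializationAt' b)
  have := hs.to_subtype
  have (b : s) : SecondCountableTopology (trivializationAt F V (b : B)).source :=
    (trivializationAt F V (b : B)).sourceHomeomorphBaseSetProd.secondCountableTopology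
  refine TopologicalSpace.secondCountableTopology_of_countable_cover
    (fun b : s => (trivializationAt F V (b : B)).open_source) (eq_univ_of_forall fun x => ?_)
  obtain ⟨b, hb, hx⟩ := mem_iUnion₂.1 (hcover ▸ mem_univ x.proj)
  exact mem_iUnion.2 ⟨⟨b, hb⟩, (trivializationAt F V b).mem_source.2 hx⟩

end FiberBundle

theorem sigmaCompactSpace_tangentBundle {F : Type*} [NormedAddCommGroup F] [NormedSpace ℝ F]
    [FiniteDimensional ℝ F] {H : Type*} [TopologicalSpace H] {I : ModelWithCorners ℝ F H}
    {N : Type*} [TopologicalSpace N] [SecondCountableTopology N] [ChartedSpace H N]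
    [IsManifold I 1 N] : SigmaCompactSpace (TangentBundle I N) := by
  have : SecondCountableTopology F := inferInstance
  have := secondCountableTopology_totalSpace F (TangentSpace I : N → Type _)
  have := I.locallyCompactSpace
  have : LocallyCompactSpace (ModelProd H F) := inferInstanceAs (LocallyCompactSpace (H × F))
  have := ChartedSpace.locallyCompactSpace (ModelProd H F) (TangentBundle I N)
  infer_instance

/-! ### Natural charts of the tangent bundle -/

section TangentBundle

variable {E : Type*} [NormedAddCommGroup E] [NormedSpace ℝ E] {Q : Type*} [TopologicalSpace Q]
  [ChartedSpace E Q] [IsManifold 𝓘(ℝ, E) ∞ Q]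

theorem contMDiff_tangentBundle_mk (q : Q) :
    ContMDiff 𝓘(ℝ, E) 𝓘(ℝ, E).tangent ∞ (fun w : E => (⟨q, w⟩ : TangentBundle 𝓘(ℝ, E) Q)) := by
  intro w
  refine contMDiffAt_totalSpace.2 ⟨contMDiffAt_const, ?_⟩
  exact ((tangentBundleCore 𝓘(ℝ, E) Q).coordChange (achart E q) (achart E q) q).contMDiffAt

theorem extChartAt_tangentBundle_mk (x : TangentBundle 𝓘(ℝ, E) Q) (w : E) :
    extChartAt 𝓘(ℝ, E).tangent x (⟨x.proj, w⟩ : TangentBundle 𝓘(ℝ, E) Q) =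
      (extChartAt 𝓘(ℝ, E) x.proj x.proj, w) :=
  Prod.ext rfl <| (tangentBundleCore 𝓘(ℝ, E) Q).coordChange_self (achart E x.proj) x.proj
    (mem_chart_source E x.proj) w

theorem mem_extChartAt_tangentBundle_target {x : TangentBundle 𝓘(ℝ, E) Q} {z : E × E} :
    z ∈ (extChartAt 𝓘(ℝ, E).tangent x).target ↔ z.1 ∈ (extChartAt 𝓘(ℝ, E) x.proj).target := by
  simp only [extChartAt_target, ModelWithCorners.range_eq_univ, inter_univ]
  exact TangentBundle.mem_chart_target_iff (I := 𝓘(ℝ, E)) z x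

theorem extChartAt_tangentBundle_symm_apply {x : TangentBundle 𝓘(ℝ, E) Q} {z : E × E}
    (hz : z.1 ∈ (extChartAt 𝓘(ℝ, E) x.proj).target) :
    (extChartAt 𝓘(ℝ, E).tangent x).symm z = (⟨(extChartAt 𝓘(ℝ, E) x.proj).symm z.1,
      mfderiv 𝓘(ℝ, E) 𝓘(ℝ, E) (extChartAt 𝓘(ℝ, E) x.proj).symm z.1 z.2⟩ :
        TangentBundle 𝓘(ℝ, E) Q) :=
  (tangentMap_chart_symm (I := 𝓘(ℝ, E)) (p := x)
    (q := (⟨z.1, z.2⟩ : TangentBundle 𝓘(ℝ, E) E)) (by simpa using hz)).symm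

theorem contMDiffOn_mfderiv_extChartAt_symm_apply (q : Q) (w : E) :
    ContMDiffOn 𝓘(ℝ, E) 𝓘(ℝ, E).tangent ∞
      (fun y : E => (⟨(extChartAt 𝓘(ℝ, E) q).symm y,
        mfderiv 𝓘(ℝ, E) 𝓘(ℝ, E) (extChartAt 𝓘(ℝ, E) q).symm y w⟩ : TangentBundle 𝓘(ℝ, E) Q))
      (extChartAt 𝓘(ℝ, E) q).target := by
  let x : TangentBundle 𝓘(ℝ, E) Q := ⟨q, (0 : E)⟩
  have hpair : ContMDiffOn 𝓘(ℝ, E) 𝓘(ℝ, E × E) ∞ (fun y : E => (y, w))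
      (extChartAt 𝓘(ℝ, E) q).target :=
    contMDiffOn_iff_contDiffOn.2 (contDiff_id.prodMk contDiff_const).contDiffOn
  refine ((contMDiffOn_extChartAt_symm (n := ∞) (I := 𝓘(ℝ, E).tangent) x).comp hpair
    fun y hy => mem_extChartAt_tangentBundle_target.2 hy).congr fun y hy => ?_
  exact (extChartAt_tangentBundle_symm_apply (x := x) (z := (y, w)) hy).symm

theorem tangentProj_mfderiv_extChartAt_symm {x : TangentBundle 𝓘(ℝ, E) Q} {z : E × E}
    (hz : z.1 ∈ (extChartAt 𝓘(ℝ, E) x.proj).target) (ζ : E × E) :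
    tangentProj ((extChartAt 𝓘(ℝ, E).tangent x).symm z)
      (mfderiv 𝓘(ℝ, E × E) 𝓘(ℝ, E).tangent (extChartAt 𝓘(ℝ, E).tangent x).symm z ζ) =
      mfderiv 𝓘(ℝ, E) 𝓘(ℝ, E) (extChartAt 𝓘(ℝ, E) x.proj).symm z.1 ζ.1 := by
  have hproj := mfderiv_comp z (I'' := 𝓘(ℝ, E))
    ((Bundle.contMDiff_proj (TangentSpace 𝓘(ℝ, E)) (n := ∞) _).mdifferentiableAt (by simp))
    (mdifferentiableAt_extChartAt_symm (I := 𝓘(ℝ, E).tangent) (x := x)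
      (mem_extChartAt_tangentBundle_target.2 hz))
  have hfst := mfderiv_comp z (I := 𝓘(ℝ, E × E)) (I'' := 𝓘(ℝ, E)) (f := Prod.fst)
    (mdifferentiableAt_extChartAt_symm (I := 𝓘(ℝ, E)) (x := x.proj) hz)
    (hasFDerivAt_fst (𝕜 := ℝ)).differentiableAt.mdifferentiableAt
  rw [mfderiv_eq_fderiv, fderiv_fst] at hfst
  exact DFunLike.congr_fun (hproj.symm.trans hfst) ζ

-- `T_x (TQ)` is by definition `E × E`, and the derivative at `x` of the preferred chart is `id`.
theorem tangentProj_eq_fst (x : TangentBundle 𝓘(ℝ, E) Q) :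
    tangentProj x = ContinuousLinearMap.fst ℝ E E := by
  have hproj := mfderiv_comp x (I'' := 𝓘(ℝ, E))
    (mdifferentiableAt_extChartAt (I := 𝓘(ℝ, E)) (mem_chart_source E x.proj))
    ((Bundle.contMDiff_proj (TangentSpace 𝓘(ℝ, E)) (n := ∞) x).mdifferentiableAt (by simp))
  have hfst := mfderiv_comp x (I' := 𝓘(ℝ, E × E)) (I'' := 𝓘(ℝ, E)) (g := Prod.fst)
    (hasFDerivAt_fst (𝕜 := ℝ)).differentiableAt.mdifferentiableAt
    (mdifferentiableAt_extChartAt (I := 𝓘(ℝ, E).tangent) (mem_chart_source (ModelProd E E) x))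
  rw [mfderiv_extChartAt_self] at hproj hfst
  rw [mfderiv_eq_fderiv, fderiv_fst] at hfst
  exact hproj.symm.trans hfst

theorem verticalLift_eq_inr (x : TangentBundle 𝓘(ℝ, E) Q) :
    verticalLift x = ContinuousLinearMap.inr ℝ E E := by
  let v : E := x.snd
  have hcomp := mfderiv_comp (I' := 𝓘(ℝ, E).tangent) v
    (mdifferentiableAt_extChartAt (I := 𝓘(ℝ, E).tangent) (mem_chart_source (ModelProd E E) x))
    ((contMDiff_tangentBundle_mk x.proj v).mdifferentiableAt (by simp))
  have hchart : extChartAt 𝓘(ℝ, E).tangent x ∘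
      (fun w : E => (⟨x.proj, w⟩ : TangentBundle 𝓘(ℝ, E) Q)) =
      fun w : E => (extChartAt 𝓘(ℝ, E) x.proj x.proj, w) :=
    funext (extChartAt_tangentBundle_mk x)
  have hinr : HasFDerivAt (fun w : E => (extChartAt 𝓘(ℝ, E) x.proj x.proj, w))
      (ContinuousLinearMap.inr ℝ E E) v :=
    (hasFDerivAt_const _ _).prodMk (hasFDerivAt_id _)
  rw [hchart, mfderiv_eq_fderiv, hinr.fderiv, mfderiv_extChartAt_self (x := x)] at hcomp
  exact hcomp.symm

end TangentBundle

/-! ### The Cartan form and the complete lift of a Riemannian metric -/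

theorem isInvertible_of_forall_apply_eq_zero {V : Type*} [NormedAddCommGroup V] [NormedSpace ℝ V]
    [FiniteDimensional ℝ V] {B : V →L[ℝ] V →L[ℝ] ℝ} (hB : ∀ v, (∀ w, B v w = 0) → v = 0) :
    B.IsInvertible := by
  have hinj : Function.Injective B.toLinearMap :=
    (injective_iff_map_eq_zero _).2 fun v hv => hB v fun w => DFunLike.congr_fun hv w
  have hrank : Module.finrank ℝ V = Module.finrank ℝ (V →L[ℝ] ℝ) :=
    Subspace.dual_finrank_eq.symm.trans LinearMap.toContinuousLinearMap.finrank_eq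
  exact ⟨(LinearEquiv.ofInjectiveOfFinrankEq B.toLinearMap hinj hrank).toContinuousLinearEquiv, rfl⟩

theorem hasFDerivAt_apply_fst_snd {F₁ F₂ G : Type*} [NormedAddCommGroup F₁] [NormedSpace ℝ F₁]
    [NormedAddCommGroup F₂] [NormedSpace ℝ F₂] [NormedAddCommGroup G] [NormedSpace ℝ G]
    {A : F₁ → F₂ →L[ℝ] G} {y : F₁} (hA : DifferentiableAt ℝ A y) (v : F₂) :
    HasFDerivAt (fun z : F₁ × F₂ => A z.1 z.2)
      ((fderiv ℝ A y).flip v ∘L .fst ℝ F₁ F₂ + A y ∘L .snd ℝ F₁ F₂) (y, v) := by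
  have hAfst : HasFDerivAt (fun z : F₁ × F₂ => A z.1) (fderiv ℝ A y ∘L .fst ℝ F₁ F₂) (y, v) :=
    hA.hasFDerivAt.comp (y, v) hasFDerivAt_fst
  convert! hAfst.clm_apply hasFDerivAt_snd using 1
  ext ζ <;> simp

theorem fderiv_apply_fst_snd_comp_fst {E : Type*} [NormedAddCommGroup E] [NormedSpace ℝ E]
    {B : E → E →L[ℝ] E →L[ℝ] ℝ} {y : E} (hB : DifferentiableAt ℝ B y) (v : E) (ζ χ : E × E) :
    fderiv ℝ (fun z : E × E => B z.1 z.2 ∘L ContinuousLinearMap.fst ℝ E E) (y, v) ζ χ =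
      fderiv ℝ B y ζ.1 v χ.1 + B y ζ.2 χ.1 := by
  rw [((hasFDerivAt_apply_fst_snd hB v).clm_comp (hasFDerivAt_const _ _)).fderiv]
  simp

section CartanForm

variable {E : Type*} [NormedAddCommGroup E] [NormedSpace ℝ E] {Q : Type*} [TopologicalSpace Q]
  [ChartedSpace E Q] [IsManifold 𝓘(ℝ, E) ∞ Q]

theorem isSmoothOneForm_oneFormVerticalLift [FiniteDimensional ℝ E]
    {α : ∀ q : Q, TangentSpace 𝓘(ℝ, E) q →L[ℝ] ℝ}
    (hα : ContMDiff 𝓘(ℝ, E) (𝓘(ℝ, E).prod 𝓘(ℝ, E →L[ℝ] ℝ)) ∞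
      (fun q => TotalSpace.mk' (E →L[ℝ] ℝ)
        (E := fun q : Q => TangentSpace 𝓘(ℝ, E) q →L[ℝ] Bundle.Trivial Q ℝ q) q (α q))) :
    IsSmoothOneForm (I := 𝓘(ℝ, E).tangent) (oneFormVerticalLift α) := by
  intro x
  refine contDiffOn_clm_apply.2 fun ζ => ?_
  let f : E → ℝ := fun y => α ((extChartAt 𝓘(ℝ, E) x.proj).symm y)
    (mfderiv 𝓘(ℝ, E) 𝓘(ℝ, E) (extChartAt 𝓘(ℝ, E) x.proj).symm y ζ.1)
  have hf : ContDiffOn ℝ ∞ f (extChartAt 𝓘(ℝ, E) x.proj).target := by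
    refine contMDiffOn_iff_contDiffOn.1 fun y hy => ?_
    have hv := contMDiffOn_mfderiv_extChartAt_symm_apply x.proj ζ.1 y hy
    have hsection : ContMDiffWithinAt 𝓘(ℝ, E) (𝓘(ℝ, E).prod 𝓘(ℝ, ℝ)) ∞
        (fun y => TotalSpace.mk' ℝ (E := Bundle.Trivial Q ℝ)
          ((extChartAt 𝓘(ℝ, E) x.proj).symm y) (f y)) (extChartAt 𝓘(ℝ, E) x.proj).target y :=
      ContMDiffWithinAt.clm_bundle_apply (F₁ := E) (E₁ := (TangentSpace 𝓘(ℝ, E) : Q → Type _))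
        (hα.contMDiffAt.comp_contMDiffWithinAt y
          ((Bundle.contMDiff_proj _ _).comp_contMDiffWithinAt y hv)) hv
    exact (contMDiffWithinAt_totalSpace.1 hsection).2
  refine (hf.comp contDiff_fst.contDiffOn fun z hz =>
    mem_extChartAt_tangentBundle_target.1 hz).congr fun z hz => ?_
  exact congrArg (α ((extChartAt 𝓘(ℝ, E) x.proj).symm z.1))
    (tangentProj_mfderiv_extChartAt_symm (mem_extChartAt_tangentBundle_target.1 hz) ζ)

/-- The one-form `v ↦ 𝒢(v, Tτ ·)` on `TQ`, namely `𝒢ᵢⱼ q̇ⁱ dqʲ`; for a mechanical Lagrangian `L` it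
is `J^*(dL)`. -/
noncomputable def cartanForm
    (g : ContMDiffRiemannianMetric 𝓘(ℝ, E) ∞ E (TangentSpace 𝓘(ℝ, E) : Q → Type _))
    (x : TangentBundle 𝓘(ℝ, E) Q) : TangentSpace 𝓘(ℝ, E).tangent x →L[ℝ] ℝ :=
  g.inner x.proj x.snd ∘L tangentProj x

variable (g : ContMDiffRiemannianMetric 𝓘(ℝ, E) ∞ E (TangentSpace 𝓘(ℝ, E) : Q → Type _))
  {x : TangentBundle 𝓘(ℝ, E) Q}

theorem contMDiffOn_metric_inner {F : Type*} [NormedAddCommGroup F] [NormedSpace ℝ F] {H : Type*}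
    [TopologicalSpace H] {I : ModelWithCorners ℝ F H} {N : Type*} [TopologicalSpace N]
    [ChartedSpace H N] {b : N → Q} {v w : ∀ y, TangentSpace 𝓘(ℝ, E) (b y)} {s : Set N}
    (hv : ContMDiffOn I 𝓘(ℝ, E).tangent ∞ (fun y => (⟨b y, v y⟩ : TangentBundle 𝓘(ℝ, E) Q)) s)
    (hw : ContMDiffOn I 𝓘(ℝ, E).tangent ∞ (fun y => (⟨b y, w y⟩ : TangentBundle 𝓘(ℝ, E) Q)) s) :
    ContMDiffOn I 𝓘(ℝ, ℝ) ∞ (fun y => g.inner (b y) (v y) (w y)) s := by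
  intro x hx
  have hb : ContMDiffWithinAt I 𝓘(ℝ, E) ∞ b s x :=
    (Bundle.contMDiff_proj (TangentSpace 𝓘(ℝ, E)) _).comp_contMDiffWithinAt x (hv x hx)
  have hsection : ContMDiffWithinAt I (𝓘(ℝ, E).prod 𝓘(ℝ, ℝ)) ∞
      (fun y => TotalSpace.mk' ℝ (E := Bundle.Trivial Q ℝ) (b y)
        (g.inner (b y) (v y) (w y))) s x :=
    ContMDiffWithinAt.clm_bundle_apply₂ (F₁ := E) (F₂ := E)
      (g.contMDiff.contMDiffAt.comp_contMDiffWithinAt x hb) (hv x hx) (hw x hx)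
  exact (contMDiffWithinAt_totalSpace.1 hsection).2

theorem contDiffOn_metricInChart [FiniteDimensional ℝ E] (q : Q) :
    ContDiffOn ℝ ∞ (metricInChart g q) (extChartAt 𝓘(ℝ, E) q).target :=
  contDiffOn_clm_apply.2 fun w => contDiffOn_clm_apply.2 fun w' =>
    contMDiffOn_iff_contDiffOn.1 (contMDiffOn_metric_inner g
      (contMDiffOn_mfderiv_extChartAt_symm_apply q w)
      (contMDiffOn_mfderiv_extChartAt_symm_apply q w'))

theorem metricInChart_extChartAt_self (q : Q) :
    metricInChart g q (extChartAt 𝓘(ℝ, E) q q) = g.inner q := by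
  have hself := mfderivWithin_range_extChartAt_symm (I := 𝓘(ℝ, E)) (x := q)
  rw [modelWithCornersSelf_coe, range_id, mfderivWithin_univ] at hself
  let T : E →L[ℝ] E := mfderiv 𝓘(ℝ, E) 𝓘(ℝ, E) (extChartAt 𝓘(ℝ, E) q).symm (extChartAt 𝓘(ℝ, E) q q)
  have hT : T = .id ℝ E := hself
  let B : Q → E →L[ℝ] E →L[ℝ] ℝ := fun p => g.inner p
  change bilinPullback (B ((extChartAt 𝓘(ℝ, E) q).symm (extChartAt 𝓘(ℝ, E) q q))) T T = B q
  rw [hT, extChartAt_to_inv]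
  rfl

theorem oneFormInChart_cartanForm {z : E × E} (hz : z ∈ (extChartAt 𝓘(ℝ, E).tangent x).target) :
    oneFormInChart 𝓘(ℝ, E).tangent (cartanForm g) x z =
      metricInChart g x.proj z.1 z.2 ∘L ContinuousLinearMap.fst ℝ E E := by
  have hz₁ := mem_extChartAt_tangentBundle_target.1 hz
  refine ContinuousLinearMap.ext fun ζ => ?_
  let B : TangentBundle 𝓘(ℝ, E) Q → E →L[ℝ] ℝ := fun y => g.inner y.proj y.snd
  exact (congrArg (B _) (tangentProj_mfderiv_extChartAt_symm hz₁ ζ)).trans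
    (DFunLike.congr_fun (congrArg B (extChartAt_tangentBundle_symm_apply hz₁)) _)

theorem completeLift_apply (x : TangentBundle 𝓘(ℝ, E) Q) (ζ χ : E × E) :
    completeLift g x ζ χ =
      fderiv ℝ (metricInChart g x.proj) (extChartAt 𝓘(ℝ, E) x.proj x.proj) x.snd ζ.1 χ.1 +
        g.inner x.proj ζ.1 χ.2 + g.inner x.proj ζ.2 χ.1 := by
  let P : E × E →L[ℝ] E × E :=
    mfderiv 𝓘(ℝ, E).tangent 𝓘(ℝ, E × E) (extChartAt 𝓘(ℝ, E).tangent x) x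
  have hP : P = .id ℝ (E × E) := mfderiv_extChartAt_self (I := 𝓘(ℝ, E).tangent) (x := x)
  let c : E × E := extChartAt 𝓘(ℝ, E).tangent x x
  have hc : c = (extChartAt 𝓘(ℝ, E) x.proj x.proj, x.snd) := extChartAt_tangentBundle_mk x x.snd
  rw [← metricInChart_extChartAt_self]
  change bilinDirDeriv (metricInChart g x.proj) c.1 c.2 (P ζ).1 (P χ).1 +
    metricInChart g x.proj c.1 (P ζ).1 (P χ).2 + metricInChart g x.proj c.1 (P ζ).2 (P χ).1 = _
  rw [hP, hc]
  rfl

theorem completeLift_verticalLift (x : TangentBundle 𝓘(ℝ, E) Q)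
    (w : TangentSpace 𝓘(ℝ, E) x.proj) :
    completeLift g x (verticalLift x w) = g.inner x.proj w ∘L tangentProj x := by
  let w' : E := w
  rw [verticalLift_eq_inr, tangentProj_eq_fst]
  refine ContinuousLinearMap.ext fun (ζ : E × E) => (completeLift_apply g x (0, w') ζ).trans ?_
  let B : E →L[ℝ] E →L[ℝ] ℝ := g.inner x.proj
  change _ + B 0 ζ.2 + B w' ζ.1 = B w' ζ.1
  simp

theorem completeLift_apply_verticalLift (x : TangentBundle 𝓘(ℝ, E) Q)
    (ξ : TangentSpace 𝓘(ℝ, E).tangent x) (w : TangentSpace 𝓘(ℝ, E) x.proj) :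
    completeLift g x ξ (verticalLift x w) = g.inner x.proj (tangentProj x ξ) w := by
  let w' : E := w
  rw [verticalLift_eq_inr, tangentProj_eq_fst]
  refine (completeLift_apply g x ξ (0, w')).trans ?_
  let B : E →L[ℝ] E →L[ℝ] ℝ := g.inner x.proj
  let ζ : E × E := ξ
  change _ + B ζ.1 w' + B ζ.2 0 = B ζ.1 w'
  simp

variable [FiniteDimensional ℝ E]

theorem isSmoothOneForm_cartanForm : IsSmoothOneForm (I := 𝓘(ℝ, E).tangent) (cartanForm g) := by
  intro x
  have hmetric : ContDiffOn ℝ ∞ (fun z : E × E => metricInChart g x.proj z.1)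
      (extChartAt 𝓘(ℝ, E).tangent x).target :=
    (contDiffOn_metricInChart g x.proj).comp contDiff_fst.contDiffOn
      fun z hz => mem_extChartAt_tangentBundle_target.1 hz
  exact ((hmetric.clm_apply contDiffOn_snd).clm_comp contDiffOn_const).congr
    fun z hz => oneFormInChart_cartanForm g hz

theorem isInvertible_metric_inner (q : Q) : (g.inner q).IsInvertible := by
  refine isInvertible_of_forall_apply_eq_zero (V := E) fun v hv => ?_
  by_contra hne
  exact (g.pos q v hne).ne' (hv v)

theorem fderiv_oneFormInChart_cartanForm (x : TangentBundle 𝓘(ℝ, E) Q) (ζ χ : E × E) :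
    fderiv ℝ (oneFormInChart 𝓘(ℝ, E).tangent (cartanForm g) x)
        (extChartAt 𝓘(ℝ, E).tangent x x) ζ χ =
      fderiv ℝ (metricInChart g x.proj) (extChartAt 𝓘(ℝ, E) x.proj x.proj) ζ.1 x.snd χ.1 +
        metricInChart g x.proj (extChartAt 𝓘(ℝ, E) x.proj x.proj) ζ.2 χ.1 := by
  have heq : oneFormInChart 𝓘(ℝ, E).tangent (cartanForm g) x
      =ᶠ[𝓝 (extChartAt 𝓘(ℝ, E).tangent x x)]
      fun z => metricInChart g x.proj z.1 z.2 ∘L ContinuousLinearMap.fst ℝ E E := by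
    filter_upwards [extChartAt_target_mem_nhds x] with z hz using oneFormInChart_cartanForm g hz
  have hmetric : DifferentiableAt ℝ (metricInChart g x.proj) (extChartAt 𝓘(ℝ, E) x.proj x.proj) :=
    ((contDiffOn_metricInChart g x.proj).contDiffAt
      (extChartAt_target_mem_nhds x.proj)).differentiableAt (by simp)
  rw [heq.fderiv_eq, extChartAt_tangentBundle_mk x x.snd]
  exact fderiv_apply_fst_snd_comp_fst hmetric _ ζ χ

theorem oneFormExtDeriv_cartanForm_verticalLift (x : TangentBundle 𝓘(ℝ, E) Q)
    (w : TangentSpace 𝓘(ℝ, E) x.proj) :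
    oneFormExtDeriv 𝓘(ℝ, E).tangent (cartanForm g) x (verticalLift x w) =
      g.inner x.proj w ∘L tangentProj x := by
  let P : E × E →L[ℝ] E × E :=
    mfderiv 𝓘(ℝ, E).tangent 𝓘(ℝ, E × E) (extChartAt 𝓘(ℝ, E).tangent x) x
  have hP : P = .id ℝ (E × E) := mfderiv_extChartAt_self (I := 𝓘(ℝ, E).tangent) (x := x)
  let D : E × E →L[ℝ] E × E →L[ℝ] ℝ :=
    fderiv ℝ (oneFormInChart 𝓘(ℝ, E).tangent (cartanForm g) x) (extChartAt 𝓘(ℝ, E).tangent x x)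
  let w' : E := w
  rw [verticalLift_eq_inr, tangentProj_eq_fst, ← metricInChart_extChartAt_self]
  refine ContinuousLinearMap.ext fun (ζ : E × E) => ?_
  change D (P (0, w')) (P ζ) - D (P ζ) (P (0, w')) =
    metricInChart g x.proj (extChartAt 𝓘(ℝ, E) x.proj x.proj) w' ζ.1
  rw [hP]
  refine (congrArg₂ (· - ·) (fderiv_oneFormInChart_cartanForm g x (0, w') ζ)
    (fderiv_oneFormInChart_cartanForm g x ζ (0, w'))).trans ?_
  simp only [ContinuousLinearMap.map_zero, add_zero, sub_zero]
  exact zero_add _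

theorem isInvertible_of_apply_verticalLift {x : TangentBundle 𝓘(ℝ, E) Q}
    {B : TangentSpace 𝓘(ℝ, E).tangent x →L[ℝ] TangentSpace 𝓘(ℝ, E).tangent x →L[ℝ] ℝ}
    {c : ℝ} (hc : c ≠ 0) (hleft : ∀ w, B (verticalLift x w) = g.inner x.proj w ∘L tangentProj x)
    (hright : ∀ ξ w, B ξ (verticalLift x w) = c * g.inner x.proj (tangentProj x ξ) w) :
    B.IsInvertible := by
  have hpos (w : TangentSpace 𝓘(ℝ, E) x.proj) (h : g.inner x.proj w w = 0) : w = 0 :=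
    by_contra fun hw => (g.pos x.proj w hw).ne' h
  refine isInvertible_of_forall_apply_eq_zero (V := E × E) (B := B) fun ξ hξ => ?_
  have hhorizontal : tangentProj x ξ = 0 := by
    refine hpos _ ((mul_eq_zero_iff_left hc).1 ?_)
    exact (hright ξ (tangentProj x ξ)).symm.trans (hξ _)
  obtain ⟨w, rfl⟩ : ∃ w, verticalLift x w = ξ := by
    rw [verticalLift_eq_inr]
    rw [tangentProj_eq_fst] at hhorizontal
    exact ⟨ξ.2, Prod.ext hhorizontal.symm rfl⟩
  obtain ⟨η, hη⟩ : ∃ η, tangentProj x η = w := by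
    rw [tangentProj_eq_fst]
    exact ⟨(w, (0 : E)), rfl⟩
  have hw : w = 0 := hpos w (hη ▸ (DFunLike.congr_fun (hleft w) η).symm.trans (hξ η))
  rw [hw]
  exact map_zero _

theorem isInvertible_oneFormExtDeriv_cartanForm (x : TangentBundle 𝓘(ℝ, E) Q) :
    (oneFormExtDeriv 𝓘(ℝ, E).tangent (cartanForm g) x).IsInvertible :=
  isInvertible_of_apply_verticalLift g (neg_ne_zero.2 one_ne_zero)
    (oneFormExtDeriv_cartanForm_verticalLift g x) fun ξ w => by
      rw [oneFormExtDeriv_swap, oneFormExtDeriv_cartanForm_verticalLift, neg_one_mul, g.symm]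
      rfl

theorem isInvertible_completeLift (x : TangentBundle 𝓘(ℝ, E) Q) :
    (completeLift g x).IsInvertible :=
  isInvertible_of_apply_verticalLift g one_ne_zero (completeLift_verticalLift g x) fun ξ w => by
    rw [completeLift_apply_verticalLift, one_mul]

end CartanForm

/-! ### Closed-loop dynamics and control laws -/

theorem hasFDerivAt_half_mul_apply_self {V : Type*} [NormedAddCommGroup V] [NormedSpace ℝ V]
    {B : V →L[ℝ] V →L[ℝ] ℝ} (hB : ∀ v w, B v w = B w v) (v : V) :
    HasFDerivAt (fun w => 1 / 2 * B w w) (B v) v := by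
  refine ((B.hasFDerivAt.clm_apply (hasFDerivAt_id v)).const_mul (1 / 2 : ℝ)).congr_fderiv ?_
  ext w
  simp only [smul_add, add_apply, smul_apply, ContinuousLinearMap.comp_apply,
    ContinuousLinearMap.id_apply, ContinuousLinearMap.flip_apply, smul_eq_mul, id, hB w v]
  ring

namespace MechanicalControlSystem

variable {E : Type*} [NormedAddCommGroup E] [NormedSpace ℝ E] {Q : Type*} [TopologicalSpace Q]
  [ChartedSpace E Q] [IsManifold 𝓘(ℝ, E) ∞ Q] {m : ℕ} (S : MechanicalControlSystem E Q m)

theorem liftedInputDistribution_eq_span (x : TangentBundle 𝓘(ℝ, E) Q) :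
    S.liftedInputDistribution x =
      Submodule.span ℝ (range fun a => vectorVerticalLift (S.controlField a) x) := by
  rw [liftedInputDistribution, inputDistribution, Submodule.map_span, ← range_comp]
  rfl

theorem map_completeLift_liftedInputDistribution (x : TangentBundle 𝓘(ℝ, E) Q) :
    (S.liftedInputDistribution x).map (completeLift S.metric x).toLinearMap =
      Submodule.span ℝ (range fun a =>
        completeLift S.metric x (vectorVerticalLift (S.controlField a) x)) := by
  rw [liftedInputDistribution_eq_span, Submodule.map_span, ← range_comp]
  rfl

theorem contMDiff_kineticEnergy : ContMDiff 𝓘(ℝ, E).tangent 𝓘(ℝ, ℝ) ∞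
    (fun x : TangentBundle 𝓘(ℝ, E) Q => 1 / 2 * S.metric.inner x.proj x.snd x.snd) :=
  contMDiff_const.mul (contMDiffOn_univ.1
    (contMDiffOn_metric_inner S.metric (I := 𝓘(ℝ, E).tangent)
      (b := fun x : TangentBundle 𝓘(ℝ, E) Q => x.proj) (v := fun x => x.snd) (w := fun x => x.snd)
      contMDiffOn_id contMDiffOn_id))

theorem contMDiff_potential_proj : ContMDiff 𝓘(ℝ, E).tangent 𝓘(ℝ, ℝ) ∞
    (fun x : TangentBundle 𝓘(ℝ, E) Q => S.potential x.proj) :=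
  S.potential_smooth.comp (Bundle.contMDiff_proj _)

theorem contMDiff_lagrangian : ContMDiff 𝓘(ℝ, E).tangent 𝓘(ℝ, ℝ) ∞ S.lagrangian :=
  S.contMDiff_kineticEnergy.sub S.contMDiff_potential_proj

theorem functionDifferential_lagrangian_verticalLift (x : TangentBundle 𝓘(ℝ, E) Q)
    (w : TangentSpace 𝓘(ℝ, E) x.proj) :
    functionDifferential S.lagrangian x (verticalLift x w) = S.metric.inner x.proj x.snd w := by
  let v : E := x.snd
  let B : E →L[ℝ] E →L[ℝ] ℝ := S.metric.inner x.proj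
  have hfibre : HasFDerivAt (fun w : E => 1 / 2 * B w w - S.potential x.proj) (B v) v :=
    (hasFDerivAt_half_mul_apply_self (V := E) (S.metric.symm x.proj) v).sub_const _
  have hL := (S.contMDiff_lagrangian (⟨x.proj, v⟩ : TangentBundle 𝓘(ℝ, E) Q)).mdifferentiableAt
    (by simp)
  have hmk := (contMDiff_tangentBundle_mk x.proj v).mdifferentiableAt (by simp)
  have hchain := mfderiv_comp v hL hmk
  have hcomp : S.lagrangian ∘ (fun w : E => (⟨x.proj, w⟩ : TangentBundle 𝓘(ℝ, E) Q)) =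
      fun w => 1 / 2 * B w w - S.potential x.proj := rfl
  rw [hcomp, mfderiv_eq_fderiv, hfibre.fderiv] at hchain
  exact (DFunLike.congr_fun hchain w).symm

theorem functionDifferential_lagrangian_comp_almostTangent :
    (fun x => functionDifferential S.lagrangian x ∘L almostTangent x) = cartanForm S.metric :=
  funext fun x => ContinuousLinearMap.ext fun ξ =>
    S.functionDifferential_lagrangian_verticalLift x (tangentProj x ξ)

theorem energy_lagrangian : energy S.lagrangian = fun x =>
    1 / 2 * S.metric.inner x.proj x.snd x.snd + S.potential x.proj := by
  funext x
  rw [energy, functionDifferential_lagrangian_verticalLift, lagrangian]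
  ring

theorem contMDiff_energy : ContMDiff 𝓘(ℝ, E).tangent 𝓘(ℝ, ℝ) ∞ (energy S.lagrangian) := by
  rw [energy_lagrangian]
  exact S.contMDiff_kineticEnergy.add S.contMDiff_potential_proj

theorem lagrangianForm_eq_neg_oneFormExtDeriv_cartanForm (x : TangentBundle 𝓘(ℝ, E) Q) :
    lagrangianForm S.lagrangian x =
      -oneFormExtDeriv 𝓘(ℝ, E).tangent (cartanForm S.metric) x := by
  rw [lagrangianForm, functionDifferential_lagrangian_comp_almostTangent]

variable [FiniteDimensional ℝ E]

theorem metric_controlField (a : Fin m) (q : Q) :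
    S.metric.inner q (S.controlField a q) = S.force a q :=
  (isInvertible_metric_inner S.metric q).self_apply_inverse _

theorem completeLift_vectorVerticalLift (a : Fin m) (x : TangentBundle 𝓘(ℝ, E) Q) :
    completeLift S.metric x (vectorVerticalLift (S.controlField a) x) =
      oneFormVerticalLift (S.force a) x := by
  rw [vectorVerticalLift, completeLift_verticalLift, metric_controlField, oneFormVerticalLift]

theorem sharp_completeLift_oneFormVerticalLift (a : Fin m) (x : TangentBundle 𝓘(ℝ, E) Q) :
    sharp (completeLift S.metric x) (oneFormVerticalLift (S.force a) x) =
      vectorVerticalLift (S.controlField a) x := by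
  rw [← completeLift_vectorVerticalLift]
  exact (isInvertible_completeLift S.metric x).inverse_apply_self _

theorem liftedInputDistribution_eq_span_sharp (x : TangentBundle 𝓘(ℝ, E) Q) :
    S.liftedInputDistribution x = Submodule.span ℝ (range fun a =>
      sharp (completeLift S.metric x) (oneFormVerticalLift (S.force a) x)) := by
  simp only [sharp_completeLift_oneFormVerticalLift, liftedInputDistribution_eq_span]

theorem map_completeLift_liftedInputDistribution_eq_span_force (x : TangentBundle 𝓘(ℝ, E) Q) :
    (S.liftedInputDistribution x).map (completeLift S.metric x).toLinearMap =
      Submodule.span ℝ (range fun a => oneFormVerticalLift (S.force a) x) := by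
  simp only [map_completeLift_liftedInputDistribution, completeLift_vectorVerticalLift]

theorem isInvertible_lagrangianForm (x : TangentBundle 𝓘(ℝ, E) Q) :
    (lagrangianForm S.lagrangian x).IsInvertible := by
  obtain ⟨e, he⟩ := isInvertible_oneFormExtDeriv_cartanForm S.metric x
  refine ⟨(ContinuousLinearEquiv.neg ℝ).trans e, ?_⟩
  rw [lagrangianForm_eq_neg_oneFormExtDeriv_cartanForm, ← he]
  ext1 ξ
  exact map_neg e ξ

theorem lagrangianForm_eulerLagrangeField (x : TangentBundle 𝓘(ℝ, E) Q) :
    lagrangianForm S.lagrangian x (eulerLagrangeField S.lagrangian x) =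
      functionDifferential (energy S.lagrangian) x :=
  (S.isInvertible_lagrangianForm x).self_apply_inverse _

theorem oneFormExtDeriv_cartanForm_vectorVerticalLift (a : Fin m) (x : TangentBundle 𝓘(ℝ, E) Q) :
    oneFormExtDeriv 𝓘(ℝ, E).tangent (cartanForm S.metric) x
      (vectorVerticalLift (S.controlField a) x) = oneFormVerticalLift (S.force a) x := by
  rw [vectorVerticalLift, oneFormExtDeriv_cartanForm_verticalLift, metric_controlField,
    oneFormVerticalLift]

theorem oneFormExtDeriv_cartanForm_eulerLagrangeField (x : TangentBundle 𝓘(ℝ, E) Q) :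
    oneFormExtDeriv 𝓘(ℝ, E).tangent (cartanForm S.metric) x (eulerLagrangeField S.lagrangian x) =
      functionDifferential (-energy S.lagrangian) x := by
  have h := S.lagrangianForm_eulerLagrangeField x
  rw [lagrangianForm_eq_neg_oneFormExtDeriv_cartanForm] at h
  exact (neg_eq_iff_eq_neg.1 h).trans mfderiv_neg.symm

theorem lagrangianForm_vectorVerticalLift (a : Fin m) (x : TangentBundle 𝓘(ℝ, E) Q) :
    lagrangianForm S.lagrangian x (vectorVerticalLift (S.controlField a) x) =
      -oneFormVerticalLift (S.force a) x := by
  rw [lagrangianForm_eq_neg_oneFormExtDeriv_cartanForm,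
    ← oneFormExtDeriv_cartanForm_vectorVerticalLift]
  rfl

theorem chetaevForm_closedLoopField (u : TangentBundle 𝓘(ℝ, E) Q → Fin m → ℝ)
    (x : TangentBundle 𝓘(ℝ, E) Q) :
    S.chetaevForm (S.closedLoopField u) x =
      -∑ a, u x a • oneFormVerticalLift (S.force a) x := by
  simp only [chetaevForm, closedLoopField, map_add, map_sum, map_smul,
    lagrangianForm_eulerLagrangeField, lagrangianForm_vectorVerticalLift, add_sub_cancel_left,
    smul_neg, Finset.sum_neg_distrib]

theorem chetaevForm_closedLoopField_mem (u : TangentBundle 𝓘(ℝ, E) Q → Fin m → ℝ)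
    (x : TangentBundle 𝓘(ℝ, E) Q) :
    S.chetaevForm (S.closedLoopField u) x ∈
      (S.liftedInputDistribution x).map (completeLift S.metric x).toLinearMap := by
  rw [chetaevForm_closedLoopField, map_completeLift_liftedInputDistribution_eq_span_force]
  exact neg_mem (Submodule.sum_smul_mem _ _ fun a _ => Submodule.subset_span (mem_range_self a))

theorem contMDiff_vectorVerticalLift_controlField (a : Fin m) :
    ContMDiff 𝓘(ℝ, E).tangent 𝓘(ℝ, E).tangent.tangent ∞
      (fun x => (⟨x, vectorVerticalLift (S.controlField a) x⟩ :
        TangentBundle 𝓘(ℝ, E).tangent (TangentBundle 𝓘(ℝ, E) Q))) :=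
  contMDiff_of_oneFormExtDeriv_eq (isSmoothOneForm_cartanForm S.metric)
    (isSmoothOneForm_oneFormVerticalLift (S.force_smooth a))
    (isInvertible_oneFormExtDeriv_cartanForm S.metric)
    (S.oneFormExtDeriv_cartanForm_vectorVerticalLift a)

theorem contMDiff_eulerLagrangeField :
    ContMDiff 𝓘(ℝ, E).tangent 𝓘(ℝ, E).tangent.tangent ∞
      (fun x => (⟨x, eulerLagrangeField S.lagrangian x⟩ :
        TangentBundle 𝓘(ℝ, E).tangent (TangentBundle 𝓘(ℝ, E) Q))) :=
  contMDiff_of_oneFormExtDeriv_eq (isSmoothOneForm_cartanForm S.metric)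
    (isSmoothOneForm_mvfderiv S.contMDiff_energy.neg)
    (isInvertible_oneFormExtDeriv_cartanForm S.metric)
    S.oneFormExtDeriv_cartanForm_eulerLagrangeField

variable {u : TangentBundle 𝓘(ℝ, E) Q → Fin m → ℝ} {M : Set (TangentBundle 𝓘(ℝ, E) Q)}

theorem contMDiff_closedLoopField (hu : ContMDiff 𝓘(ℝ, E).tangent 𝓘(ℝ, Fin m → ℝ) ∞ u) :
    ContMDiff 𝓘(ℝ, E).tangent 𝓘(ℝ, E).tangent.tangent ∞
      (fun x => (⟨x, S.closedLoopField u x⟩ :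
        TangentBundle 𝓘(ℝ, E).tangent (TangentBundle 𝓘(ℝ, E) Q))) :=
  S.contMDiff_eulerLagrangeField.add_section <| ContMDiff.sum_section fun a _ =>
    (contMDiff_pi_space.1 hu a).smul_section (S.contMDiff_vectorVerticalLift_controlField a)

variable (hM : IsClosedSubmanifold 𝓘(ℝ, E).tangent m M)

include hM

theorem isFlowInvariant_closedLoopField_iff
    (hu : ContMDiff 𝓘(ℝ, E).tangent 𝓘(ℝ, Fin m → ℝ) ∞ u) :
    IsFlowInvariant 𝓘(ℝ, E).tangent (S.closedLoopField u) M ↔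
      ∀ x ∈ M, S.closedLoopField u x ∈ submanifoldTangentSpace 𝓘(ℝ, E).tangent M x :=
  have : CompleteSpace E := FiniteDimensional.complete ℝ E
  isFlowInvariant_iff_forall_mem_submanifoldTangentSpace hM
    ((S.contMDiff_closedLoopField hu).of_le (by simp))

variable (hsup : ∀ x ∈ M,
  submanifoldTangentSpace 𝓘(ℝ, E).tangent M x ⊔ S.liftedInputDistribution x = ⊤)

include hsup

variable {S} in
theorem IsControlLaw.apply_eq_of_mem_submanifoldTangentSpace {τ : M → Fin m → ℝ}
    (hτ : S.IsControlLaw M τ) {x : M}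
    (hx : S.closedLoopField u x ∈ submanifoldTangentSpace 𝓘(ℝ, E).tangent M x) :
    τ x = u x := by
  obtain ⟨v, hv, hvτ, hinvariant⟩ := hτ
  have htangent := (S.isFlowInvariant_closedLoopField_iff hM hv).1 hinvariant x x.2
  have hspan := hsup x x.2
  rw [liftedInputDistribution_eq_span] at hspan
  rw [← hvτ x]
  exact (existsUnique_add_sum_smul_mem_submanifoldTangentSpace hM x.2 hspan
    (eulerLagrangeField S.lagrangian x)).unique htangent hx

theorem existsUnique_isControlLaw [T2Space Q] [SecondCountableTopology Q] :
    ∃! τ : M → Fin m → ℝ, S.IsControlLaw M τ := by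
  have : T2Space (TangentBundle 𝓘(ℝ, E) Q) := t2Space_totalSpace E (TangentSpace 𝓘(ℝ, E))
  have : SigmaCompactSpace (TangentBundle 𝓘(ℝ, E) Q) := sigmaCompactSpace_tangentBundle
  obtain ⟨u, hu, htangent⟩ := exists_contMDiff_add_sum_smul_mem_submanifoldTangentSpace hM
    S.contMDiff_eulerLagrangeField S.contMDiff_vectorVerticalLift_controlField
    fun x hx => S.liftedInputDistribution_eq_span x ▸ hsup x hx
  exact ⟨fun x => u x,
    ⟨u, hu, fun _ => rfl, (S.isFlowInvariant_closedLoopField_iff hM hu).2 htangent⟩,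
    fun τ hτ => funext fun x =>
      hτ.apply_eq_of_mem_submanifoldTangentSpace hM hsup (htangent x x.2)⟩

end MechanicalControlSystem

theorem mainTheorem1
    {E : Type*} [NormedAddCommGroup E] [NormedSpace ℝ E] [FiniteDimensional ℝ E]
    {Q : Type*} [TopologicalSpace Q] [T2Space Q] [SecondCountableTopology Q]
    [ChartedSpace E Q] [IsManifold 𝓘(ℝ, E) ∞ Q]
    {m : ℕ} (S : MechanicalControlSystem E Q m)
    (M : Set (TangentBundle 𝓘(ℝ, E) Q))
    (hM : IsClosedSubmanifold 𝓘(ℝ, E).tangent m M)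
    (htrans : ∀ x ∈ M,
      Transversal (submanifoldTangentSpace 𝓘(ℝ, E).tangent M x) (S.liftedInputDistribution x)) :
    -- the Euler-Lagrange vector field is well defined
    (∀ x, lagrangianForm S.lagrangian x (eulerLagrangeField S.lagrangian x) =
      functionDifferential (energy S.lagrangian) x) ∧
    -- there is a unique control law
    (∃! τ : M → Fin m → ℝ, S.IsControlLaw M τ) ∧
    -- and it characterizes the closed-loop vector fields leaving the constraint invariant
    (∀ τ : M → Fin m → ℝ, S.IsControlLaw M τ →
      ∀ u : TangentBundle 𝓘(ℝ, E) Q → Fin m → ℝ,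
        ContMDiff 𝓘(ℝ, E).tangent 𝓘(ℝ, Fin m → ℝ) ∞ u →
        List.TFAE [
          IsFlowInvariant 𝓘(ℝ, E).tangent (S.closedLoopField u) M,
          ∀ x : M,
            S.chetaevForm (S.closedLoopField u) x =
              -∑ a, τ x a • oneFormVerticalLift (S.force a) (x : TangentBundle 𝓘(ℝ, E) Q) ∧
            S.closedLoopField u x ∈ submanifoldTangentSpace 𝓘(ℝ, E).tangent M x,
          ∀ x : M,
            S.chetaevForm (S.closedLoopField u) x ∈
              (S.liftedInputDistribution x).map (completeLift S.metric x).toLinearMap ∧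
            S.closedLoopField u x ∈ submanifoldTangentSpace 𝓘(ℝ, E).tangent M x]) ∧
    -- the lifted input distribution and its image under the flat map of the complete lift
    (∀ x : TangentBundle 𝓘(ℝ, E) Q,
      S.liftedInputDistribution x = Submodule.span ℝ (range fun a =>
        sharp (completeLift S.metric x) (oneFormVerticalLift (S.force a) x)) ∧
      (S.liftedInputDistribution x).map (completeLift S.metric x).toLinearMap =
        Submodule.span ℝ (range fun a =>
          completeLift S.metric x (vectorVerticalLift (S.controlField a) x)) ∧
      (S.liftedInputDistribution x).map (completeLift S.metric x).toLinearMap =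
        Submodule.span ℝ (range fun a => oneFormVerticalLift (S.force a) x)) := by
  have hsup := fun x hx => (htrans x hx).1
  refine ⟨S.lagrangianForm_eulerLagrangeField, S.existsUnique_isControlLaw hM hsup, ?_,
    fun x => ⟨S.liftedInputDistribution_eq_span_sharp x,
      S.map_completeLift_liftedInputDistribution x,
      S.map_completeLift_liftedInputDistribution_eq_span_force x⟩⟩
  intro τ hτ u hu
  tfae_have 1 → 2 := fun hinvariant x => by
    have htangent := (S.isFlowInvariant_closedLoopField_iff hM hu).1 hinvariant x x.2
    rw [hτ.apply_eq_of_mem_submanifoldTangentSpace hM hsup htangent]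
    exact ⟨S.chetaevForm_closedLoopField u x, htangent⟩
  tfae_have 2 → 3 := fun h x => ⟨S.chetaevForm_closedLoopField_mem u x, (h x).2⟩
  tfae_have 3 → 1 := fun h =>
    (S.isFlowInvariant_closedLoopField_iff hM hu).2 fun x hx => (h ⟨x, hx⟩).2
  tfae_finish
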